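/- **Theorem 1.5.** Let $n\ge 1$ be an integer, $\nu_1\ge 0$, $\nu_2<0$, $\beta>1$, and consider the Cauchy problem $$w_{tt}-\Delta w+\frac{\nu_1}{(1+t)^{\beta}}w_t+\frac{\nu_2}{(1+t)^2}w=|w|^p \ \text{ in } \mathbb{R}^n\times(0,T),\qquad w(x,0)=\varepsilon f(x),\quad w_t(x,0)=\varepsilon g(x). \tag{1}$$ Notation: $\gamma_F(p,\nu)=2-\nu(p-1)$, $\gamma_S(p,\nu)=2+(\nu+1)p-(\nu-1)p^2$; $p_F(\nu)=1+\frac2\nu$ if $\nu>0$ and $p_F(\nu)=+\infty$ if $\nu\le0$; $p_S(\nu)=\frac{\nu+1+\sqrt{\nu^2+10\nu-7}}{2(\nu-1)}$ if $\nu>1$ and $p_S(\nu)=+\infty$ if $\nu\le1$. An *energy solution* of (1) on $[0,T)$, $0<T\le\infty$, is a function $w\in C([0,T),H^1(\mathbb{R}^n))\cap C^1([0,T),L^2(\mathbb{R}^n))\cap C((0,T),L^p_{loc}(\mathbb{R}^n))$ with $w(\cdot,0)=\varepsilon f$ in $H^1$, $w_t(\cdot,0)=\varepsilon g$ in $L^2$,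 such that for every $\phi\in C_0^\infty(\mathbb{R}^n\times[0,T))$ and every $t\in[0,T)$ the integral $\int_0^t\!\int_{\mathbb{R}^n}|w|^p\phi\,dx\,ds$ converges and $$\int_{\mathbb{R}^n} w_t(x,t)\phi(x,t)\,dx+\int_0^t\!\!\int_{\mathbb{R}^n}\{-w_t\phi_t+\nabla w\cdot\nabla\phi\}\,dx\,ds+\int_0^t\!\!\int_{\mathbb{R}^n}\frac{\nu_1}{(1+s)^\beta}w_t\phi\,dx\,ds+\int_0^t\!\!\int_{\mathbb{R}^n}\frac{\nu_2}{(1+s)^2}w\phi\,dx\,ds=\int_{\mathbb{R}^n}\varepsilon g(x)\phi(x,0)\,dx+\int_0^t\!\!\int_{\mathbb{R}^n}|w|^p\phi\,dx\,ds .$$ Set $$\delta:=1-4\nu_2e^{\nu_1/(1-\beta)},\qquad d_*(n):=\tfrac12\left(-1-n+\sqrt{n^2+10n-7}\right),\qquad p_\delta(n):=\max\left\{p_F\!\left(n-\tfrac{1+\sqrt\delta}{2}\right),\,p_S(n)\right\}.$$ Then $\delta>1$, $d_*(n)\in[0,2)$, and $$p_\delta(n)=\begin{cases}p_S(n)&\text{if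 } n\ge2,\ \sqrt\delta\le n-d_*(n),\\ p_F\!\left(n-\frac{1+\sqrt\delta}{2}\right)&\text{if } n\ge2,\ n-d_*(n)<\sqrt\delta<2n-1,\\ +\infty&\text{if } n=1, \text{ or if } n\ge2,\ \sqrt\delta\ge2n-1.\end{cases}$$ Moreover, let $1<p<p_\delta(n)$, let $f\in H^1(\mathbb{R}^n)$ and $g\in L^2(\mathbb{R}^n)$ be non-negative and not both vanishing, and let $R\ge1$. Let $T_\varepsilon$ be the blow-up time of (1), i.e. the supremum of all $T\in(0,\infty]$ for which (1) has an energy solution $w$ on $[0,T)$ with $\operatorname{supp}w\subset\{(x,t)\in\mathbb{R}^n\times[0,\infty):|x|\le t+R\}$ (with $T_\varepsilon=0$ if there is none). Then there are constants $\varepsilon_5>0$ and $C>0$, depending only on $f,g,\beta,\nu_1,\nu_2,n,p,R$, such that for all $0<\varepsilon\le\varepsilon_5$: * if $\sqrt\delta\le n-2$, then $T_\varepsilon\le C\,\varepsilon^{-2p(p-1)/\gamma_S(p,n)}$; * if $n-2<\sqrt\delta<n-d_*(n)$, then $$T_\varepsilon\le\begin{cases}C\,\varepsilon^{-(p-1)/\gamma_F(p,n-(1+\sqrt\delta)/2)}&\text{if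 } 1<p\le\frac{2}{n-\sqrt\delta},\\ C\,\varepsilon^{-2p(p-1)/\gamma_S(p,n)}&\text{if } \frac{2}{n-\sqrt\delta}<p<p_\delta(n);\end{cases}$$ * if $\sqrt\delta\ge n-d_*(n)$, then $T_\varepsilon\le C\,\varepsilon^{-(p-1)/\gamma_F(p,n-(1+\sqrt\delta)/2)}$, where $\varepsilon^{-(p-1)/\gamma_F(p,n-(1+\sqrt\delta)/2)}=\varepsilon^{-\left[2/(p-1)-n+(1+\sqrt\delta)/2\right]^{-1}}$. -/

import Mathlib

open MeasureTheory Set Filter Topology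
open scoped ENNReal ContDiff

noncomputable section

namespace NegMass

/-! ### Exponents -/

/-- The Fujita exponent `p_F(ν)`, with value `+∞` for `ν ≤ 0`. -/
def pF (ν : ℝ) : EReal :=
  if 0 < ν then ((1 + 2 / ν : ℝ) : EReal) else ⊤

/-- The Strauss exponent `p_S(ν)`, with value `+∞` for `ν ≤ 1`. -/
def pS (ν : ℝ) : EReal :=
  if 1 < ν then (((ν + 1 + √(ν ^ 2 + 10 * ν - 7)) / (2 * (ν - 1)) : ℝ) : EReal) else ⊤

/-- `γ_F(p, ν) = 2 - ν (p - 1)`. -/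
def gammaF (p ν : ℝ) : ℝ := 2 - ν * (p - 1)

/-- `γ_S(p, ν) = 2 + (ν + 1) p - (ν - 1) p²`. -/
def gammaS (p ν : ℝ) : ℝ := 2 + (ν + 1) * p - (ν - 1) * p ^ 2

/-- `δ = 1 - 4 ν₂ e^{ν₁ / (1 - β)}`. -/
def delta (ν₁ ν₂ β : ℝ) : ℝ := 1 - 4 * ν₂ * Real.exp (ν₁ / (1 - β))

/-- `d_*(n) = (-1 - n + √(n² + 10 n - 7)) / 2`. -/
def dStar (n : ℝ) : ℝ := (-1 - n + √(n ^ 2 + 10 * n - 7)) / 2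

/-- `p_δ(n) = max {p_F(n - (1 + √δ) / 2), p_S(n)}`. -/
def pDelta (δ n : ℝ) : EReal := max (pF (n - (1 + √δ) / 2)) (pS n)

/-! ### Function spaces -/

/-- The Euclidean space `ℝⁿ`. -/
abbrev Space (n : ℕ) := EuclideanSpace ℝ (Fin n)

/-- Real-valued `L²(ℝⁿ)`. -/
abbrev L2 (n : ℕ) := Lp ℝ 2 (volume : Measure (Space n))

/-- Vector fields in `L²(ℝⁿ; ℝⁿ)`. -/
abbrev L2Vec (n : ℕ) := Lp (Space n) 2 (volume : Measure (Space n))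

/-- `G` is the weak (distributional) gradient of `u`:
`∫ u ∂ₑφ = - ∫ ⟨G, e⟩ φ` for all `φ ∈ C_c^∞(ℝⁿ)` and all directions `e`. -/
def IsWeakGradient {n : ℕ} (u : L2 n) (G : L2Vec n) : Prop :=
  ∀ φ : Space n → ℝ, ContDiff ℝ ∞ φ → HasCompactSupport φ → ∀ e : Space n,
    ∫ x, u x * fderiv ℝ φ x e = -∫ x, inner ℝ (G x) e * φ x

lemma integrable_mul_test {n : ℕ} (u : L2 n) {ψ : Space n → ℝ} (hψ : Continuous ψ)
    (hc : HasCompactSupport ψ) : Integrable (fun x => u x * ψ x) :=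
  (Lp.memLp u).integrable_mul (q := 2) (hψ.memLp_of_hasCompactSupport hc)

lemma integrable_inner_mul_test {n : ℕ} (G : L2Vec n) (e : Space n) {ψ : Space n → ℝ}
    (hψ : Continuous ψ) (hc : HasCompactSupport ψ) :
    Integrable (fun x => inner ℝ (G x) e * ψ x) :=
  ((Lp.memLp G).inner_const e).integrable_mul (q := 2) (hψ.memLp_of_hasCompactSupport hc)

/-- The Sobolev space `H¹(ℝⁿ)`: pairs `(u, ∇u)` of an `L²` function and its weak gradient, where
the gradient is in `L²`. Since the gradient is determined by `u`, this is the usual space, and the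
topology inherited from `L² × L²` is the one given by the `H¹` norm. -/
def H1 (n : ℕ) : Submodule ℝ (L2 n × L2Vec n) where
  carrier := {q | IsWeakGradient q.1 q.2}
  zero_mem' := by
    intro φ _ _ e
    have h1 : (fun x => ((0 : L2 n × L2Vec n).1 : Space n → ℝ) x * fderiv ℝ φ x e)
        =ᵐ[volume] fun _ => (0 : ℝ) := by
      filter_upwards [Lp.coeFn_zero ℝ 2 (volume : Measure (Space n))] with x hx
      simp
    have h2 : (fun x => inner ℝ (((0 : L2 n × L2Vec n).2 : Space n → Space n) x) e * φ x)
        =ᵐ[volume] fun _ => (0 : ℝ) := by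
      filter_upwards [Lp.coeFn_zero (Space n) 2 (volume : Measure (Space n))] with x hx
      simp
    rw [integral_congr_ae h1, integral_congr_ae h2]
    simp
  add_mem' := by
    intro a b ha hb φ hφ hc e
    have hd : Continuous fun x => fderiv ℝ φ x e :=
      (hφ.continuous_fderiv (by simp)).clm_apply continuous_const
    have hdc : HasCompactSupport fun x => fderiv ℝ φ x e := hc.fderiv_apply ℝ e
    have h1 : (fun x => ((a + b).1 : Space n → ℝ) x * fderiv ℝ φ x e)
        =ᵐ[volume] fun x => a.1 x * fderiv ℝ φ x e + b.1 x * fderiv ℝ φ x e := by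
      filter_upwards [Lp.coeFn_add a.1 b.1] with x hx
      simp only [Prod.fst_add, hx, Pi.add_apply, add_mul]
    have h2 : (fun x => inner ℝ (((a + b).2 : Space n → Space n) x) e * φ x)
        =ᵐ[volume] fun x => inner ℝ (a.2 x) e * φ x + inner ℝ (b.2 x) e * φ x := by
      filter_upwards [Lp.coeFn_add a.2 b.2] with x hx
      simp only [Prod.snd_add, hx, Pi.add_apply, inner_add_left, add_mul]
    rw [integral_congr_ae h1, integral_congr_ae h2,
      integral_add (integrable_mul_test _ hd hdc) (integrable_mul_test _ hd hdc),
      integral_add (integrable_inner_mul_test _ e hφ.continuous hc)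
        (integrable_inner_mul_test _ e hφ.continuous hc),
      ha φ hφ hc e, hb φ hφ hc e, neg_add]
  smul_mem' := by
    intro c a ha φ hφ hc e
    have h1 : (fun x => ((c • a).1 : Space n → ℝ) x * fderiv ℝ φ x e)
        =ᵐ[volume] fun x => c * (a.1 x * fderiv ℝ φ x e) := by
      filter_upwards [Lp.coeFn_smul c a.1] with x hx
      simp only [Prod.smul_fst, hx, Pi.smul_apply, smul_eq_mul, mul_assoc]
    have h2 : (fun x => inner ℝ (((c • a).2 : Space n → Space n) x) e * φ x)
        =ᵐ[volume] fun x => c * (inner ℝ (a.2 x) e * φ x) := by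
      filter_upwards [Lp.coeFn_smul c a.2] with x hx
      simp only [Prod.smul_snd, hx, Pi.smul_apply, real_inner_smul_left, mul_assoc]
    rw [integral_congr_ae h1, integral_congr_ae h2, integral_const_mul, integral_const_mul,
      ha φ hφ hc e, mul_neg]

/-- The underlying `L²` function of an element of `H¹`. -/
def fn {n : ℕ} (f : H1 n) : L2 n := f.1.1

/-- The weak gradient of an element of `H¹`. -/
def grad {n : ℕ} (f : H1 n) : L2Vec n := f.1.2

/-! ### Energy solutions -/

/-- The time interval `[0, T)`, where `0 < T ≤ ∞`. -/
def timeInterval (T : ℝ≥0∞) : Set ℝ := {t | 0 ≤ t ∧ ENNReal.ofReal t < T}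

/-- The time derivative in `L²` of a curve on `[0, T)` (one-sided at `t = 0`). -/
def timeDeriv {n : ℕ} (T : ℝ≥0∞) (w : ℝ → H1 n) (t : ℝ) : L2 n :=
  derivWithin (fun s => fn (w s)) (timeInterval T) t

/-- The test functions `C_0^∞(ℝⁿ × [0, T))`, written with the time variable first: restrictions to
`t ≥ 0` of smooth functions on space-time whose support is compact and lies in `t < T`; they need
not vanish at `t = 0`. -/
def IsTestFunction {n : ℕ} (T : ℝ≥0∞) (φ : ℝ × Space n → ℝ) : Prop :=
  ContDiff ℝ ∞ φ ∧ HasCompactSupport φ ∧ ∀ z ∈ tsupport φ, ENNReal.ofReal z.1 < T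

/-- `w` is an energy solution on `[0, T)` of
`w_tt - Δw + ν₁ (1+t)^{-β} w_t + ν₂ (1+t)^{-2} w = |w|^p`, `w(0) = ε f`, `w_t(0) = ε g`. -/
structure IsEnergySolution {n : ℕ} (ν₁ ν₂ β p ε : ℝ) (f : H1 n) (g : L2 n) (T : ℝ≥0∞)
    (w : ℝ → H1 n) : Prop where
  pos : 0 < T
  /-- `w ∈ C([0,T), H¹)` -/
  continuousOn : ContinuousOn w (timeInterval T)
  /-- `w ∈ C¹([0,T), L²)` -/
  contDiffOn : ContDiffOn ℝ 1 (fun t => fn (w t)) (timeInterval T)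
  /-- `w(t) ∈ L^p_loc` for `t ∈ (0,T)` -/
  memLp_loc : ∀ t ∈ timeInterval T, 0 < t → ∀ K : Set (Space n), IsCompact K →
    MemLp (fn (w t)) (ENNReal.ofReal p) (volume.restrict K)
  /-- `w ∈ C((0,T), L^p_loc)` -/
  continuous_loc : ∀ t ∈ timeInterval T, 0 < t → ∀ K : Set (Space n), IsCompact K →
    Tendsto (fun s => eLpNorm (fun x => fn (w s) x - fn (w t) x) (ENNReal.ofReal p)
      (volume.restrict K)) (𝓝[timeInterval T] t) (𝓝 0)
  init : w 0 = ε • f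
  init_deriv : timeDeriv T w 0 = ε • g
  /-- The space-time integral of the nonlinear term in the weak formulation is a convergent one
  up to the initial time. -/
  integrable : ∀ φ : ℝ × Space n → ℝ, IsTestFunction T φ → ∀ t ∈ timeInterval T,
    IntervalIntegrable (fun s => ∫ x, |fn (w s) x| ^ p * φ (s, x)) volume 0 t
  /-- The weak formulation. -/
  weak : ∀ φ : ℝ × Space n → ℝ, IsTestFunction T φ → ∀ t ∈ timeInterval T,
    (∫ x, timeDeriv T w t x * φ (t, x))
      + (∫ s in (0 : ℝ)..t, ∫ x,
          (-(timeDeriv T w s x * deriv (fun r => φ (r, x)) s)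
            + fderiv ℝ (fun y => φ (s, y)) x (grad (w s) x)))
      + (∫ s in (0 : ℝ)..t, ∫ x, ν₁ / (1 + s) ^ β * timeDeriv T w s x * φ (s, x))
      + (∫ s in (0 : ℝ)..t, ∫ x, ν₂ / (1 + s) ^ 2 * fn (w s) x * φ (s, x))
    = (∫ x, ε * g x * φ (0, x))
      + ∫ s in (0 : ℝ)..t, ∫ x, |fn (w s) x| ^ p * φ (s, x)

/-- `supp w ⊆ {(x, t) : |x| ≤ t + R}` for a curve `w` on `[0, T)`. -/
def SupportedInCone {n : ℕ} (R : ℝ) (T : ℝ≥0∞) (w : ℝ → H1 n) : Prop :=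
  ∀ t ∈ timeInterval T, ∀ᵐ x : Space n, t + R < ‖x‖ → fn (w t) x = 0

/-- The blow-up time (lifespan) `T_ε`: the supremum of all `T ∈ (0, ∞]` such that there is an energy
solution on `[0, T)` with support in the cone `|x| ≤ t + R`. -/
def lifespan {n : ℕ} (ν₁ ν₂ β p R ε : ℝ) (f : H1 n) (g : L2 n) : ℝ≥0∞ :=
  sSup {T | ∃ w : ℝ → H1 n,
    IsEnergySolution ν₁ ν₂ β p ε f g T w ∧ SupportedInCone R T w}

end NegMass

end

/-!
The nonlinearity is bounded below through the moments `∫ w(x, t) e^{⟨x, ξ⟩} dx`; as `w` lives in a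
cone, cut-off exponentials are admissible test functions. After multiplication by
`m(t) = exp (ν₁ (1 + t)^(1 - β) / (1 - β))`, which absorbs the integrable damping and satisfies
`m(0) ≤ m ≤ 1`, each moment `G` solves `(m G')' = m ((|ξ|² - ν₂ (1 + t)^(-2)) G + N)` with source
`N = ∫ |w|^p e^{⟨x, ξ⟩} dx ≥ 0`.

For the mass `F` (the case `ξ = 0`), Hölder's inequality on the ball of radius `t + R` gives
`N ≳ (1 + t)^(-n (p - 1)) F^p`. Hence `F(t + r) ≳ r² (1 + t + r)^(-n (p - 1)) F(t)^p`, and iterating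
this with geometrically decreasing `r` makes `F` infinite at time `2τ` as soon as
`τ^(2 - n (p - 1)) F(τ)^(p - 1)` is large. A lower bound `F ≳ ε^θ t^a` therefore forces
`T_ε ≲ ε^(-θ (p - 1) / Γ)` whenever `Γ = 2 - n (p - 1) + a (p - 1) > 0`.

Two such bounds are available. Dropping `N` and comparing with Euler's equation gives `θ = 1` and
`a = (1 + √δ) / 2`, hence the Fujita-type estimate. For `1 ≤ |ξ| ≤ 2` the moments are at least of
size `ε e^{|ξ| t}`; Hölder's inequality and an average over `ξ` turn this into
`∫ |w|^p dx ≳ ε^p t^((n - 1) (2 - p) / 2)`, so that `θ = p` and `a = (n - 1) (2 - p) / 2 + 2`, hence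
the Strauss-type estimate.
-/

namespace NegMass

open Metric

/-! ### Critical exponents -/

lemma one_lt_delta {ν₁ ν₂ β : ℝ} (hν₂ : ν₂ < 0) : 1 < delta ν₁ ν₂ β := by
  have : 0 < -ν₂ * Real.exp (ν₁ / (1 - β)) := mul_pos (neg_pos.2 hν₂) (Real.exp_pos _)
  unfold delta
  linarith

lemma dStar_nonneg {n : ℝ} (hn : 1 ≤ n) : 0 ≤ dStar n := by
  have : n + 1 ≤ √(n ^ 2 + 10 * n - 7) := Real.le_sqrt_of_sq_le (by nlinarith)
  unfold dStar
  linarith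

lemma dStar_lt_two {n : ℝ} (hn : 1 ≤ n) : dStar n < 2 := by
  have : √(n ^ 2 + 10 * n - 7) < n + 5 := (Real.sqrt_lt' (by linarith)).2 (by nlinarith)
  unfold dStar
  linarith

lemma dStar_sq_add {n : ℝ} (hn : 1 ≤ n) : dStar n ^ 2 + (n + 1) * dStar n = 2 * (n - 1) := by
  have h : √(n ^ 2 + 10 * n - 7) ^ 2 = n ^ 2 + 10 * n - 7 := Real.sq_sqrt (by nlinarith)
  unfold dStar
  linear_combination h / 4

lemma antitone_pF : Antitone pF := by
  intro ν μ h
  unfold pF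
  split_ifs with hμ hν hν
  · exact EReal.coe_le_coe_iff.2 (by gcongr)
  · exact le_top
  · exact absurd (hν.trans_le h) hμ
  · exact le_rfl

lemma pS_eq_pF {n : ℝ} (hn : 1 ≤ n) : pS n = pF ((n - 1 + dStar n) / 2) := by
  have hd := dStar_nonneg hn
  rcases hn.eq_or_lt with rfl | hn
  · have h : dStar 1 = 0 := by nlinarith [dStar_sq_add hn]
    simp [pS, pF, h]
  · have hsqrt : √(n ^ 2 + 10 * n - 7) = 2 * dStar n + n + 1 := by unfold dStar; ring
    have hn' : n - 1 ≠ 0 := by linarith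
    have hd' : n - 1 + dStar n ≠ 0 := by linarith
    rw [pS, pF, if_pos hn, if_pos (by linarith), hsqrt]
    congr 1
    field_simp
    linear_combination 2 * dStar_sq_add hn.le

lemma pDelta_eq_pS {n δ : ℝ} (hn : 1 ≤ n) (h : √δ ≤ n - dStar n) : pDelta δ n = pS n :=
  max_eq_right ((antitone_pF (by linarith)).trans_eq (pS_eq_pF hn).symm)

lemma pDelta_eq_pF {n δ : ℝ} (hn : 1 ≤ n) (h : n - dStar n ≤ √δ) :
    pDelta δ n = pF (n - (1 + √δ) / 2) :=
  max_eq_left ((pS_eq_pF hn).trans_le (antitone_pF (by linarith)))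

lemma pDelta_one (δ : ℝ) : pDelta δ 1 = ⊤ := by
  rw [pDelta, pS, if_neg (lt_irrefl _), max_eq_right le_top]

lemma pDelta_eq_top_of_le_sqrt {n δ : ℝ} (h : 2 * n - 1 ≤ √δ) : pDelta δ n = ⊤ := by
  rw [pDelta, pF, if_neg (by linarith), max_eq_left le_top]

lemma gammaF_pos {p ν : ℝ} (hp : 1 < p) (h : (p : EReal) < pF ν) : 0 < gammaF p ν := by
  unfold gammaF
  unfold pF at h
  split_ifs at h with hν
  · have h : p - 1 < 2 / ν := by linarith [EReal.coe_lt_coe_iff.1 h]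
    rw [lt_div_iff₀ hν] at h
    linarith
  · nlinarith

lemma gammaS_eq_mul {n : ℝ} (hn : 1 ≤ n) (p : ℝ) :
    gammaS p n = (2 - dStar n * p) * (1 + (n + 1 + dStar n) / 2 * p) := by
  unfold gammaS
  linear_combination p ^ 2 / 2 * dStar_sq_add hn

lemma gammaS_pos {p n : ℝ} (hn : 1 ≤ n) (hp : 1 < p) (h : (p : EReal) < pS n) :
    0 < gammaS p n := by
  have hd := dStar_nonneg hn
  have hF : 0 < gammaF p ((n - 1 + dStar n) / 2) := gammaF_pos hp (pS_eq_pF hn ▸ h)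
  have hid : (2 - dStar n) * gammaF p ((n - 1 + dStar n) / 2) = 2 * (2 - dStar n * p) := by
    unfold gammaF
    linear_combination (p - 1) / 2 * dStar_sq_add hn
  have hfac : 0 < 2 - dStar n * p := by
    linarith [mul_pos (sub_pos.2 (dStar_lt_two hn)) hF]
  rw [gammaS_eq_mul hn]
  positivity

lemma gammaS_sub_gammaF (p n σ : ℝ) :
    gammaS p n - 2 * p * gammaF p (n - (1 + σ) / 2) = (p - 1) * (p * (n - σ) - 2) := by
  unfold gammaS gammaF
  ring

lemma gammaF_pos_of_lt_pDelta {p n δ : ℝ} (hn : 1 ≤ n) (hp : 1 < p)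
    (h : (p : EReal) < pDelta δ n) (h' : p * (n - √δ) ≤ 2) :
    0 < gammaF p (n - (1 + √δ) / 2) := by
  rcases lt_max_iff.1 h with h | h
  · exact gammaF_pos hp h
  · have hsub : (p - 1) * (p * (n - √δ) - 2) ≤ 0 :=
      mul_nonpos_of_nonneg_of_nonpos (by linarith) (by linarith)
    refine (mul_pos_iff_of_pos_left (by linarith : 0 < 2 * p)).1 ?_
    linarith [gammaS_pos hn hp h, gammaS_sub_gammaF p n √δ]

lemma gammaS_pos_of_lt_pDelta {p n δ : ℝ} (hn : 1 ≤ n) (hp : 1 < p)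
    (h : (p : EReal) < pDelta δ n) (h' : 2 ≤ p * (n - √δ)) : 0 < gammaS p n := by
  rcases lt_max_iff.1 h with h | h
  · have hsub : 0 ≤ (p - 1) * (p * (n - √δ) - 2) := mul_nonneg (by linarith) (by linarith)
    have hF : 0 < 2 * p * gammaF p (n - (1 + √δ) / 2) :=
      mul_pos (by linarith) (gammaF_pos hp h)
    linarith [gammaS_sub_gammaF p n √δ]
  · exact gammaS_pos hn hp h

/-! ### Damped second order inequalities -/

section Calculus

variable {f f' g : ℝ → ℝ} {a b t : ℝ}

lemma monotoneOn_of_hasDerivAt_nonneg (hf : ContinuousOn f (Icc a b))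
    (hf' : ∀ t ∈ Ioo a b, HasDerivAt f (f' t) t) (hnn : ∀ t ∈ Ioo a b, 0 ≤ f' t) :
    MonotoneOn f (Icc a b) := by
  refine monotoneOn_of_hasDerivWithinAt_nonneg (f' := f') (convex_Icc a b) hf ?_ ?_ <;>
    rw [interior_Icc]
  · exact fun t ht => (hf' t ht).hasDerivWithinAt
  · exact hnn

/-- The integrating factor method: if `E' = q E` then `(E f)' = E (f' + q f)`. -/
lemma monotoneOn_integratingFactor {q r E P : ℝ → ℝ}
    (hf : ContinuousOn f (Icc a b)) (hf' : ∀ t ∈ Ioo a b, HasDerivAt f (f' t) t)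
    (hE : ContinuousOn E (Icc a b)) (hE' : ∀ t ∈ Ioo a b, HasDerivAt E (q t * E t) t)
    (hE0 : ∀ t ∈ Ioo a b, 0 ≤ E t)
    (hP : ContinuousOn P (Icc a b)) (hP' : ∀ t ∈ Ioo a b, HasDerivAt P (E t * r t) t)
    (h : ∀ t ∈ Ioo a b, r t ≤ f' t + q t * f t) :
    MonotoneOn (fun t => E t * f t - P t) (Icc a b) := by
  refine monotoneOn_of_hasDerivAt_nonneg ((hE.mul hf).sub hP)
    (fun t ht => ((hE' t ht).mul (hf' t ht)).sub (hP' t ht)) fun t ht => ?_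
  have := mul_le_mul_of_nonneg_left (h t ht) (hE0 t ht)
  linarith

lemma hasDerivAt_primitive (hg : ContinuousOn g (Icc a b)) (ht : t ∈ Ioo a b) :
    HasDerivAt (fun t => ∫ s in a..t, g s) (g t) t := by
  refine intervalIntegral.integral_hasDerivAt_right (ContinuousOn.intervalIntegrable (hg.mono ?_))
    ((hg.mono Ioo_subset_Icc_self).stronglyMeasurableAtFilter isOpen_Ioo t ht)
    (hg.continuousAt (Icc_mem_nhds ht.1 ht.2))
  rw [uIcc_of_le ht.1.le]
  exact Icc_subset_Icc_right ht.2.le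

lemma continuousOn_primitive (hg : ContinuousOn g (Icc a b)) :
    ContinuousOn (fun t => ∫ s in a..t, g s) (Icc a b) := by
  rcases le_or_gt a b with hab | hab
  · have := intervalIntegral.continuousOn_primitive_interval (f := g) (a := a) (b := b)
      (μ := volume) (by rw [uIcc_of_le hab]; exact hg.integrableOn_Icc)
    rwa [uIcc_of_le hab] at this
  · simp [Icc_eq_empty hab.not_ge]

lemma nonpos_of_le_mul_integral {L : ℝ} (hL : 0 ≤ L) (hg : ContinuousOn g (Icc a b))
    (h : ∀ t ∈ Icc a b, g t ≤ L * ∫ s in a..t, g s) (ht : t ∈ Icc a b) : g t ≤ 0 := by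
  have hab : a ≤ b := ht.1.trans ht.2
  have hmono := monotoneOn_integratingFactor (a := a) (b := b)
    (f := fun t => -∫ s in a..t, g s) (E := fun t => Real.exp (-(L * t))) (P := fun _ => 0)
    (q := fun _ => -L) (r := fun _ => 0)
    (continuousOn_primitive hg).neg (fun t ht => (hasDerivAt_primitive hg ht).neg) (by fun_prop)
    (fun t _ => (((hasDerivAt_id t).const_mul L).neg.exp).congr_deriv (by simp; ring))
    (fun _ _ => (Real.exp_pos _).le) continuousOn_const
    (fun t _ => (hasDerivAt_const t (0 : ℝ)).congr_deriv (by simp))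
    (fun t ht => by linarith [h t (Ioo_subset_Icc_self ht)]) (left_mem_Icc.2 hab) ht ht.1
  have hint : ∫ s in a..t, g s ≤ 0 := by
    simpa [mul_nonpos_iff, (Real.exp_pos _).le, (Real.exp_pos _).not_ge] using hmono
  exact (h t ht).trans (mul_nonpos_of_nonneg_of_nonpos hL hint)

lemma hasDerivAt_exp_const_mul (c t : ℝ) :
    HasDerivAt (fun s => Real.exp (c * s)) (c * Real.exp (c * t)) t :=
  (((hasDerivAt_id t).const_mul c).exp).congr_deriv (by simp [mul_comm])

lemma hasDerivAt_one_add_rpow (e : ℝ) (ht : 0 ≤ t) :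
    HasDerivAt (fun s => (1 + s) ^ e) (e * (1 + t) ^ (e - 1)) t := by
  have h := ((hasDerivAt_id t).const_add 1).rpow_const (p := e)
    (Or.inl (show 1 + id t ≠ 0 from (add_pos_of_pos_of_nonneg one_pos ht).ne'))
  exact h.congr_deriv (by rw [id_eq, one_mul])

lemma continuousOn_one_add_rpow (e b : ℝ) :
    ContinuousOn (fun s : ℝ => (1 + s) ^ e) (Icc 0 b) :=
  fun _ hs => (hasDerivAt_one_add_rpow e hs.1).continuousAt.continuousWithinAt

end Calculus

/-- A multiplier absorbing a damping term: if `m' = b m` with a damping coefficient `b ≥ 0`, then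
`m (y'' + b y') = (m y')'`. Only the properties of `m` needed for lower bounds are recorded. -/
structure IsMultiplier (m : ℝ → ℝ) : Prop where
  pos : 0 < m 0
  differentiableAt : ∀ t, 0 ≤ t → DifferentiableAt ℝ m t
  deriv_nonneg : ∀ t, 0 ≤ t → 0 ≤ deriv m t
  le_one : ∀ t, 0 ≤ t → m t ≤ 1

namespace IsMultiplier

variable {m : ℝ → ℝ} {t b : ℝ}

lemma continuousOn (hm : IsMultiplier m) : ContinuousOn m (Icc 0 b) :=
  fun _ ht => (hm.differentiableAt _ ht.1).continuousAt.continuousWithinAt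

lemma zero_le (hm : IsMultiplier m) (ht : 0 ≤ t) : m 0 ≤ m t :=
  monotoneOn_of_hasDerivAt_nonneg hm.continuousOn
    (fun s hs => (hm.differentiableAt s hs.1.le).hasDerivAt)
    (fun s hs => hm.deriv_nonneg s hs.1.le) (left_mem_Icc.2 ht) (right_mem_Icc.2 ht) ht

lemma pos_of_nonneg (hm : IsMultiplier m) (ht : 0 ≤ t) : 0 < m t := hm.pos.trans_le (hm.zero_le ht)

lemma le_mul (hm : IsMultiplier m) (ht : 0 ≤ t) {y : ℝ} (hy : 0 ≤ y) : m 0 * y ≤ m t * y :=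
  mul_le_mul_of_nonneg_right (hm.zero_le ht) hy

lemma mul_le (hm : IsMultiplier m) (ht : 0 ≤ t) {y : ℝ} (hy : 0 ≤ y) : m t * y ≤ y :=
  mul_le_of_le_one_left hy (hm.le_one t ht)

lemma neg_div_le (hm : IsMultiplier m) (ht : 0 ≤ t) {c y : ℝ} (hc : 0 ≤ c) (h : -c ≤ m t * y) :
    -(c / m 0) ≤ y := by
  rcases le_total 0 y with hy | hy
  · exact (neg_nonpos.2 (div_nonneg hc hm.pos.le)).trans hy
  · rw [neg_le, le_div_iff₀ hm.pos]
    linarith [hm.le_mul ht (neg_nonneg.2 hy)]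

end IsMultiplier

/-- A solution `G` of `(m G')' = m (V G + N)` on `[0, t₁]`, in integrated form with `H = G'`, with
nonnegative data `G 0`, `H 0`, source `N` and potential `V`. For a wave equation with damping
absorbed by `m`, `G` is a spatial moment of the solution and `N` that of the nonlinearity. -/
structure IsMoment (m V : ℝ → ℝ) (t₁ : ℝ) (G H N : ℝ → ℝ) : Prop where
  multiplier : IsMultiplier m
  continuousOn_potential : ContinuousOn V (Icc 0 t₁)
  potential_nonneg : ∀ t ∈ Icc 0 t₁, 0 ≤ V t
  zero_nonneg : 0 ≤ G 0
  deriv_zero_nonneg : 0 ≤ H 0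
  continuousOn : ContinuousOn G (Icc 0 t₁)
  hasDerivAt : ∀ t ∈ Ioo 0 t₁, HasDerivAt G (H t) t
  source_nonneg : ∀ t ∈ Ioc 0 t₁, 0 ≤ N t
  integrable : IntervalIntegrable (fun s => m s * N s) volume 0 t₁
  eq : ∀ t ∈ Icc 0 t₁, m t * H t
    = m 0 * H 0 + (∫ s in 0..t, m s * (V s * G s)) + ∫ s in 0..t, m s * N s

/-- The part of `m G'` that does not involve the source. -/
noncomputable def linearPart (m V G H : ℝ → ℝ) (t : ℝ) : ℝ :=
  m 0 * H 0 + ∫ s in 0..t, m s * (V s * G s)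

lemma linearPart_zero (m V G H : ℝ → ℝ) : linearPart m V G H 0 = m 0 * H 0 := by
  rw [linearPart, intervalIntegral.integral_same, add_zero]

namespace IsMoment

variable {m V G H N : ℝ → ℝ} {t₁ t : ℝ}

lemma continuousOn_integrand (h : IsMoment m V t₁ G H N) :
    ContinuousOn (fun s => m s * (V s * G s)) (Icc 0 t₁) :=
  h.multiplier.continuousOn.mul (h.continuousOn_potential.mul h.continuousOn)

lemma continuousOn_linearPart (h : IsMoment m V t₁ G H N) :
    ContinuousOn (linearPart m V G H) (Icc 0 t₁) :=
  continuousOn_const.add (continuousOn_primitive h.continuousOn_integrand)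

lemma hasDerivAt_linearPart (h : IsMoment m V t₁ G H N) (ht : t ∈ Ioo 0 t₁) :
    HasDerivAt (linearPart m V G H) (m t * (V t * G t)) t :=
  (hasDerivAt_primitive h.continuousOn_integrand ht).const_add _

lemma integral_source_mono (h : IsMoment m V t₁ G H N) {l u : ℝ}
    (hl : 0 ≤ l) (hlu : l ≤ u) (hut : u ≤ t) (ht : t ≤ t₁) :
    ∫ r in l..u, m r * N r ≤ ∫ r in 0..t, m r * N r := by
  refine intervalIntegral.integral_mono_interval hl hlu hut ?_ (h.integrable.mono_set ?_)
  · refine ae_restrict_of_forall_mem measurableSet_Ioc fun r hr => ?_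
    exact mul_nonneg (h.multiplier.pos_of_nonneg hr.1.le).le
      (h.source_nonneg r ⟨hr.1, hr.2.trans ht⟩)
  · have ht0 : 0 ≤ t := hl.trans (hlu.trans hut)
    rw [uIcc_of_le ht0, uIcc_of_le (ht0.trans ht)]
    exact Icc_subset_Icc_right ht

lemma linearPart_le (h : IsMoment m V t₁ G H N) (ht : t ∈ Icc 0 t₁) :
    linearPart m V G H t ≤ m t * H t := by
  have hN := h.integral_source_mono le_rfl le_rfl ht.1 ht.2
  rw [intervalIntegral.integral_same] at hN
  rw [h.eq t ht, linearPart]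
  linarith

lemma continuousOn_negPart (h : IsMoment m V t₁ G H N) :
    ContinuousOn (fun s => (G s)⁻) (Icc 0 t₁) :=
  h.continuousOn.neg.sup continuousOn_const

lemma intervalIntegrable_negPart (h : IsMoment m V t₁ G H N) (ht : t ∈ Icc 0 t₁) :
    IntervalIntegrable (fun s => (G s)⁻) volume 0 t :=
  (h.continuousOn_negPart.mono
    (by rw [uIcc_of_le ht.1]; exact Icc_subset_Icc_right ht.2)).intervalIntegrable

lemma neg_mul_integral_negPart_le (h : IsMoment m V t₁ G H N) {Q : ℝ}
    (hQ : ∀ s ∈ Icc 0 t₁, V s ≤ Q) (ht : t ∈ Icc 0 t₁) :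
    -(Q * ∫ s in 0..t, (G s)⁻) ≤ linearPart m V G H t := by
  have hint : ∫ s in 0..t, -(Q * (G s)⁻) ≤ ∫ s in 0..t, m s * (V s * G s) := by
    refine intervalIntegral.integral_mono_on ht.1
      ((h.intervalIntegrable_negPart ht).const_mul Q).neg
      ((h.continuousOn_integrand.mono ?_).intervalIntegrable) fun s hs => ?_
    · rw [uIcc_of_le ht.1]
      exact Icc_subset_Icc_right ht.2
    have hs' : s ∈ Icc 0 t₁ := ⟨hs.1, hs.2.trans ht.2⟩
    have hV := h.potential_nonneg s hs'
    calc -(Q * (G s)⁻) ≤ -(m s * (V s * (G s)⁻)) := neg_le_neg <|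
          (h.multiplier.mul_le hs.1 (mul_nonneg hV (negPart_nonneg _))).trans
            (mul_le_mul_of_nonneg_right (hQ s hs') (negPart_nonneg _))
      _ = m s * (V s * -(G s)⁻) := by ring
      _ ≤ m s * (V s * G s) := by
          have := (h.multiplier.pos_of_nonneg hs.1).le
          gcongr
          exact neg_le.1 (neg_le_negPart _)
  rw [intervalIntegral.integral_neg, intervalIntegral.integral_const_mul] at hint
  exact hint.trans (le_add_of_nonneg_left (mul_nonneg h.multiplier.pos.le h.deriv_zero_nonneg))

lemma neg_mul_le_deriv (h : IsMoment m V t₁ G H N) {Q : ℝ} (hQ : ∀ s ∈ Icc 0 t₁, V s ≤ Q)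
    (hQ0 : 0 ≤ Q) (ht : t ∈ Icc 0 t₁) {s : ℝ} (hs : s ∈ Icc 0 t) :
    -(Q * (∫ r in 0..t, (G r)⁻) / m 0) ≤ H s := by
  have hs' : s ∈ Icc 0 t₁ := ⟨hs.1, hs.2.trans ht.2⟩
  have hmono : ∫ r in 0..s, (G r)⁻ ≤ ∫ r in 0..t, (G r)⁻ :=
    intervalIntegral.integral_mono_interval le_rfl hs.1 hs.2
      (ae_of_all _ fun r => negPart_nonneg _) (h.intervalIntegrable_negPart ht)
  refine h.multiplier.neg_div_le hs.1 (mul_nonneg hQ0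
    (intervalIntegral.integral_nonneg ht.1 fun r _ => negPart_nonneg _)) ?_
  calc -(Q * ∫ r in 0..t, (G r)⁻) ≤ -(Q * ∫ r in 0..s, (G r)⁻) := by gcongr
    _ ≤ linearPart m V G H s := h.neg_mul_integral_negPart_le hQ hs'
    _ ≤ m s * H s := h.linearPart_le hs'

lemma negPart_le_mul_integral (h : IsMoment m V t₁ G H N) {Q : ℝ}
    (hQ : ∀ s ∈ Icc 0 t₁, V s ≤ Q) (hQ0 : 0 ≤ Q) (ht : t ∈ Icc 0 t₁) :
    (G t)⁻ ≤ Q / m 0 * t₁ * ∫ s in 0..t, (G s)⁻ := by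
  set U := ∫ s in 0..t, (G s)⁻
  have hU : 0 ≤ Q * U / m 0 := div_nonneg
    (mul_nonneg hQ0 (intervalIntegral.integral_nonneg ht.1 fun s _ => negPart_nonneg _))
    h.multiplier.pos.le
  have hG : G 0 ≤ G t + Q * U / m 0 * t := by
    have := monotoneOn_of_hasDerivAt_nonneg (f := fun s => G s + Q * U / m 0 * s)
      ((h.continuousOn.mono (Icc_subset_Icc_right ht.2)).add (by fun_prop))
      (fun s hs => (h.hasDerivAt s ⟨hs.1, hs.2.trans_le ht.2⟩).add
        ((hasDerivAt_id s).const_mul (Q * U / m 0)))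
      (fun s hs => by linarith [h.neg_mul_le_deriv hQ hQ0 ht (Ioo_subset_Icc_self hs)])
      (left_mem_Icc.2 ht.1) (right_mem_Icc.2 ht.1) ht.1
    simpa only [mul_zero, add_zero] using this
  calc (G t)⁻ ≤ Q * U / m 0 * t₁ := sup_le
        (by linarith [h.zero_nonneg, mul_le_mul_of_nonneg_left ht.2 hU])
        (mul_nonneg hU (ht.1.trans ht.2))
    _ = Q / m 0 * t₁ * U := by ring

lemma nonneg (h : IsMoment m V t₁ G H N) (ht : t ∈ Icc 0 t₁) : 0 ≤ G t := by
  obtain ⟨z, hz, hQ⟩ := isCompact_Icc.exists_isMaxOn ⟨t, ht⟩ h.continuousOn_potential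
  have hQ0 := h.potential_nonneg z hz
  refine negPart_eq_zero.1 (le_antisymm ?_ (negPart_nonneg _))
  exact nonpos_of_le_mul_integral (g := fun s => (G s)⁻)
    (mul_nonneg (div_nonneg hQ0 h.multiplier.pos.le) (ht.1.trans ht.2)) h.continuousOn_negPart
    (fun s hs => h.negPart_le_mul_integral hQ hQ0 hs) ht

lemma linearPart_nonneg (h : IsMoment m V t₁ G H N) (ht : t ∈ Icc 0 t₁) :
    0 ≤ linearPart m V G H t := by
  refine add_nonneg (mul_nonneg h.multiplier.pos.le h.deriv_zero_nonneg)
    (intervalIntegral.integral_nonneg ht.1 fun s hs => ?_)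
  have hs' : s ∈ Icc 0 t₁ := ⟨hs.1, hs.2.trans ht.2⟩
  exact mul_nonneg (h.multiplier.pos_of_nonneg hs.1).le
    (mul_nonneg (h.potential_nonneg s hs') (h.nonneg hs'))

lemma deriv_nonneg (h : IsMoment m V t₁ G H N) (ht : t ∈ Icc 0 t₁) : 0 ≤ H t :=
  nonneg_of_mul_nonneg_right ((h.linearPart_nonneg ht).trans (h.linearPart_le ht))
    (h.multiplier.pos_of_nonneg ht.1)

lemma linearPart_le_deriv (h : IsMoment m V t₁ G H N) (ht : t ∈ Icc 0 t₁) :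
    linearPart m V G H t ≤ H t :=
  (h.linearPart_le ht).trans (h.multiplier.mul_le ht.1 (h.deriv_nonneg ht))

lemma monotoneOn (h : IsMoment m V t₁ G H N) : MonotoneOn G (Icc 0 t₁) :=
  monotoneOn_of_hasDerivAt_nonneg h.continuousOn h.hasDerivAt
    fun _ ht => h.deriv_nonneg (Ioo_subset_Icc_self ht)

lemma mul_le_deriv_of_le_source (h : IsMoment m V t₁ G H N) {t u s l : ℝ} (ht : 0 ≤ t)
    (htu : t ≤ u) (hus : u ≤ s) (hs : s ≤ t₁) (hl0 : 0 ≤ l) (hl : ∀ r ∈ Ioo t u, l ≤ N r) :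
    m 0 * l * (u - t) ≤ H s := by
  have hs' : s ∈ Icc 0 t₁ := ⟨ht.trans (htu.trans hus), hs⟩
  have hint : IntervalIntegrable (fun r => m r * N r) volume t u := h.integrable.mono_set (by
    rw [uIcc_of_le htu, uIcc_of_le (hs'.1.trans hs)]
    exact Icc_subset_Icc ht (hus.trans hs))
  calc m 0 * l * (u - t) = ∫ _ in t..u, m 0 * l := by
        rw [intervalIntegral.integral_const, smul_eq_mul, mul_comm]
    _ ≤ ∫ r in t..u, m r * N r :=
        intervalIntegral.integral_mono_on_of_le_Ioo htu intervalIntegrable_const hint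
          fun r hr => (h.multiplier.le_mul (ht.trans hr.1.le) hl0).trans
            (mul_le_mul_of_nonneg_left (hl r hr)
              (h.multiplier.pos_of_nonneg (ht.trans hr.1.le)).le)
    _ ≤ ∫ r in 0..s, m r * N r := h.integral_source_mono ht htu hus hs
    _ ≤ m s * H s := by
        rw [h.eq s hs']
        exact le_add_of_nonneg_left (h.linearPart_nonneg hs')
    _ ≤ H s := h.multiplier.mul_le hs'.1 (h.deriv_nonneg hs')

lemma add_le_of_le_source (h : IsMoment m V t₁ G H N) {t r l : ℝ} (ht : 0 ≤ t) (hr : 0 ≤ r)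
    (htr : t + r ≤ t₁) (hl0 : 0 ≤ l) (hl : ∀ s ∈ Ioo t (t + r), l ≤ N s) :
    G t + m 0 * l * r ^ 2 / 4 ≤ G (t + r) := by
  have hsub : Icc (t + r / 2) (t + r) ⊆ Icc 0 t₁ := Icc_subset_Icc (by linarith) htr
  have hH : ∀ s ∈ Ioo (t + r / 2) (t + r), m 0 * l * (r / 2) ≤ H s := fun s hs => by
    simpa only [add_sub_cancel_left] using h.mul_le_deriv_of_le_source ht (u := t + r / 2)
      (by linarith) hs.1.le (hs.2.le.trans htr) hl0 fun q hq => hl q ⟨hq.1, by linarith [hq.2]⟩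
  have hgrow := monotoneOn_of_hasDerivAt_nonneg (f := fun s => G s - m 0 * l * (r / 2) * s)
    ((h.continuousOn.mono hsub).sub (by fun_prop))
    (fun s hs => (h.hasDerivAt s ⟨by linarith [hs.1], hs.2.trans_le htr⟩).sub
      ((hasDerivAt_id s).const_mul (m 0 * l * (r / 2))))
    (fun s hs => by linarith [hH s hs])
    (left_mem_Icc.2 (by linarith)) (right_mem_Icc.2 (by linarith)) (by linarith)
  have hmono : G t ≤ G (t + r / 2) :=
    h.monotoneOn ⟨ht, by linarith⟩ ⟨by linarith, by linarith⟩ (by linarith)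
  linarith

section MassGrowth

variable {k : ℝ}

lemma mul_rpow_le_linearPart_add (h : IsMoment m V t₁ G H N) (hk : 1 ≤ k)
    (hV : ∀ s ∈ Icc 0 t₁, k * (k - 1) ≤ m 0 * V s * (1 + s) ^ 2) (ht : t ∈ Icc 0 t₁) :
    (m 0 * H 0 + (k - 1) * G 0) * (1 + t) ^ k
      ≤ (1 + t) * linearPart m V G H t + (k - 1) * G t := by
  have hmono := monotoneOn_integratingFactor (a := 0) (b := t₁)
    (f := fun s => (1 + s) * linearPart m V G H s + (k - 1) * G s)
    (E := fun s => (1 + s) ^ (-k)) (q := fun s => -k / (1 + s)) (P := fun _ => 0)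
    (r := fun _ => 0)
    (((by fun_prop : ContinuousOn (fun s : ℝ => 1 + s) _).mul h.continuousOn_linearPart).add
      (continuousOn_const.mul h.continuousOn))
    (fun s hs => (((hasDerivAt_id s).const_add 1).mul (h.hasDerivAt_linearPart hs)).add
      ((h.hasDerivAt s hs).const_mul (k - 1)))
    (continuousOn_one_add_rpow _ _)
    (fun s hs => (hasDerivAt_one_add_rpow (-k) hs.1.le).congr_deriv (by
      rw [Real.rpow_sub_one (by linarith [hs.1])]; ring))
    (fun s hs => Real.rpow_nonneg (by linarith [hs.1]) _) continuousOn_const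
    (fun s _ => (hasDerivAt_const s (0 : ℝ)).congr_deriv (by simp)) (fun s hs => ?_)
    (left_mem_Icc.2 (ht.1.trans ht.2)) ht ht.1
  · simp only [add_zero, Real.one_rpow, one_mul, sub_zero, linearPart_zero] at hmono
    have h1t : 0 < 1 + t := by linarith [ht.1]
    rwa [Real.rpow_neg h1t.le, inv_mul_eq_div, le_div_iff₀ (by positivity)] at hmono
  · have hs' := Ioo_subset_Icc_self hs
    have h1s : 0 < 1 + s := by linarith [hs.1]
    have hG := h.nonneg hs'
    have hpot : k * (k - 1) / (1 + s) * G s ≤ (1 + s) * (m s * (V s * G s)) := by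
      rw [div_mul_eq_mul_div, div_le_iff₀ h1s]
      calc k * (k - 1) * G s ≤ m 0 * V s * (1 + s) ^ 2 * G s :=
            mul_le_mul_of_nonneg_right (hV s hs') hG
        _ = m 0 * (V s * (1 + s) ^ 2 * G s) := by ring
        _ ≤ m s * (V s * (1 + s) ^ 2 * G s) := h.multiplier.le_mul hs.1.le
            (by have := h.potential_nonneg s hs'; positivity)
        _ = _ := by ring
    have hA := mul_le_mul_of_nonneg_left (h.linearPart_le_deriv hs') (sub_nonneg.2 hk)
    have hcancel : -k / (1 + s) * ((1 + s) * linearPart m V G H s + (k - 1) * G s)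
        = -(k * linearPart m V G H s + k * (k - 1) / (1 + s) * G s) := by
      field_simp
    simp only [id_eq]
    linarith

/-- If the potential dominates `k (k - 1) / (1 + t) ^ 2`, the moment grows at least like the
solution `(1 + t) ^ k` of the Euler equation with that potential. -/
lemma mul_rpow_le (h : IsMoment m V t₁ G H N) (hk : 1 ≤ k)
    (hV : ∀ s ∈ Icc 0 t₁, k * (k - 1) ≤ m 0 * V s * (1 + s) ^ 2) (ht : t ∈ Icc 1 t₁) :
    (m 0 * H 0 + (k - 1) * G 0) / (2 * (2 * k - 1)) * (1 + t) ^ k ≤ G t := by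
  set Y := m 0 * H 0 + (k - 1) * G 0
  have hY : 0 ≤ Y := add_nonneg (mul_nonneg h.multiplier.pos.le h.deriv_zero_nonneg)
    (mul_nonneg (by linarith) h.zero_nonneg)
  have hk' : 0 < 2 * k - 1 := by linarith
  have ht0 : t ∈ Icc 0 t₁ := ⟨by linarith [ht.1], ht.2⟩
  have h1t : 0 < 1 + t := by linarith [ht.1]
  have hmono := monotoneOn_integratingFactor (a := 0) (b := t₁) (f := G)
    (E := fun s => (1 + s) ^ (k - 1)) (q := fun s => (k - 1) / (1 + s))
    (P := fun s => Y / (2 * k - 1) * (1 + s) ^ (2 * k - 1))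
    (r := fun s => Y * (1 + s) ^ (k - 1)) h.continuousOn h.hasDerivAt
    (continuousOn_one_add_rpow _ _)
    (fun s hs => (hasDerivAt_one_add_rpow _ hs.1.le).congr_deriv (by
      rw [Real.rpow_sub_one (by linarith [hs.1])]; ring))
    (fun s hs => Real.rpow_nonneg (by linarith [hs.1]) _)
    (continuousOn_const.mul (continuousOn_one_add_rpow _ _))
    (fun s hs => ((hasDerivAt_one_add_rpow (2 * k - 1) hs.1.le).const_mul _).congr_deriv (by
      rw [show 2 * k - 1 - 1 = (k - 1) + (k - 1) by ring, Real.rpow_add (by linarith [hs.1])]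
      field_simp))
    (fun s hs => ?_) (left_mem_Icc.2 (ht0.1.trans ht.2)) ht0 ht0.1
  · have htwo : 2 ≤ (1 + t) ^ (2 * k - 1) :=
      (Real.self_le_rpow_of_one_le one_le_two (by linarith)).trans
        (Real.rpow_le_rpow two_pos.le (by linarith [ht.1]) hk'.le)
    have hsplit : (1 + t) ^ (2 * k - 1) = (1 + t) ^ (k - 1) * (1 + t) ^ k := by
      rw [← Real.rpow_add h1t]
      ring_nf
    refine le_of_mul_le_mul_left ?_ (Real.rpow_pos_of_pos h1t (k - 1))
    have hstep := mul_le_mul_of_nonneg_left htwo (div_nonneg hY hk'.le)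
    have hhalf : Y / (2 * (2 * k - 1)) = Y / (2 * k - 1) / 2 := by rw [div_div, mul_comm 2]
    simp only [add_zero, Real.one_rpow, one_mul, mul_one] at hmono
    rw [mul_left_comm, ← hsplit, hhalf]
    linarith [h.zero_nonneg]
  · have hs' := Ioo_subset_Icc_self hs
    have h1s : 0 < 1 + s := by linarith [hs.1]
    have hlin := h.mul_rpow_le_linearPart_add hk hV hs'
    have hA := mul_le_mul_of_nonneg_left (h.linearPart_le_deriv hs') h1s.le
    have hcancel : (H s + (k - 1) / (1 + s) * G s) * (1 + s) = (1 + s) * H s + (k - 1) * G s := by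
      field_simp
    rw [Real.rpow_sub_one h1s.ne', ← mul_div_assoc, div_le_iff₀ h1s, hcancel]
    exact hlin.trans (by linarith)

end MassGrowth

section ExponentialGrowth

variable {κ : ℝ}

lemma mul_exp_le_linearPart_add (h : IsMoment m V t₁ G H N) (hκ : 0 ≤ κ)
    (hV : ∀ s ∈ Icc 0 t₁, κ ^ 2 ≤ V s) (ht : t ∈ Icc 0 t₁) :
    m 0 * (H 0 + κ * G 0) * Real.exp (κ * t) ≤ linearPart m V G H t + κ * (m t * G t) := by
  have hmono := monotoneOn_integratingFactor (a := 0) (b := t₁)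
    (f := fun s => linearPart m V G H s + κ * (m s * G s))
    (E := fun s => Real.exp (-κ * s)) (q := fun _ => -κ) (P := fun _ => 0) (r := fun _ => 0)
    (h.continuousOn_linearPart.add
      (continuousOn_const.mul (h.multiplier.continuousOn.mul h.continuousOn)))
    (fun s hs => (h.hasDerivAt_linearPart hs).add
      (((h.multiplier.differentiableAt s hs.1.le).hasDerivAt.mul (h.hasDerivAt s hs)).const_mul κ))
    (by fun_prop) (fun s _ => hasDerivAt_exp_const_mul _ s)
    (fun _ _ => (Real.exp_pos _).le) continuousOn_const
    (fun s _ => (hasDerivAt_const s (0 : ℝ)).congr_deriv (by simp)) (fun s hs => ?_)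
    (left_mem_Icc.2 (ht.1.trans ht.2)) ht ht.1
  · simp only [mul_zero, Real.exp_zero, one_mul, sub_zero, linearPart_zero, neg_mul,
      Real.exp_neg] at hmono
    rw [inv_mul_eq_div, le_div_iff₀ (Real.exp_pos _)] at hmono
    refine le_of_eq_of_le ?_ hmono
    ring
  · have hs' := Ioo_subset_Icc_self hs
    have hG := h.nonneg hs'
    have hms := (h.multiplier.pos_of_nonneg hs.1.le).le
    have hpot : κ * (κ * (m s * G s)) ≤ m s * (V s * G s) := by
      have := mul_le_mul_of_nonneg_right (hV s hs') (mul_nonneg hms hG)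
      linarith
    have hA := mul_le_mul_of_nonneg_left (h.linearPart_le hs') hκ
    have hm' := mul_nonneg hκ (mul_nonneg (h.multiplier.deriv_nonneg s hs.1.le) hG)
    linarith

lemma mul_exp_le (h : IsMoment m V t₁ G H N) (hκ : 1 ≤ κ)
    (hV : ∀ s ∈ Icc 0 t₁, κ ^ 2 ≤ V s) (ht : t ∈ Icc 1 t₁) :
    m 0 * (H 0 + κ * G 0) / (4 * κ) * Real.exp (κ * t) ≤ G t := by
  have hκ0 : 0 < κ := by linarith
  set Z := m 0 * (H 0 + κ * G 0)
  have hZ : 0 ≤ Z := mul_nonneg h.multiplier.pos.le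
    (add_nonneg h.deriv_zero_nonneg (mul_nonneg hκ0.le h.zero_nonneg))
  have ht0 : t ∈ Icc 0 t₁ := ⟨by linarith [ht.1], ht.2⟩
  have hmono := monotoneOn_integratingFactor (a := 0) (b := t₁) (f := G)
    (E := fun s => Real.exp (κ * s)) (q := fun _ => κ)
    (P := fun s => Z / (2 * κ) * Real.exp (2 * κ * s)) (r := fun s => Z * Real.exp (κ * s))
    h.continuousOn h.hasDerivAt (by fun_prop) (fun s _ => hasDerivAt_exp_const_mul κ s)
    (fun _ _ => (Real.exp_pos _).le) (by fun_prop)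
    (fun s _ => ((hasDerivAt_exp_const_mul (2 * κ) s).const_mul _).congr_deriv (by
      rw [show 2 * κ * s = κ * s + κ * s by ring, Real.exp_add]
      field_simp))
    (fun s hs => ?_) (left_mem_Icc.2 (ht0.1.trans ht.2)) ht0 ht0.1
  · have hsplit : Real.exp (2 * κ * t) = Real.exp (κ * t) * Real.exp (κ * t) := by
      rw [← Real.exp_add]
      ring_nf
    have htwo : 2 ≤ Real.exp (2 * κ * t) := by
      have : 1 ≤ κ * t := one_le_mul_of_one_le_of_one_le hκ ht.1
      linarith [Real.add_one_le_exp (2 * κ * t)]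
    refine le_of_mul_le_mul_left ?_ (Real.exp_pos (κ * t))
    have hstep := mul_le_mul_of_nonneg_left htwo (div_nonneg hZ (mul_pos two_pos hκ0).le)
    have hhalf : Z / (4 * κ) = Z / (2 * κ) / 2 := by rw [div_div]; ring_nf
    simp only [mul_zero, Real.exp_zero, one_mul, mul_one] at hmono
    rw [mul_left_comm, ← hsplit, hhalf]
    linarith [h.zero_nonneg]
  · have hs' := Ioo_subset_Icc_self hs
    have hm := h.multiplier.mul_le hs.1.le (mul_nonneg hκ0.le (h.nonneg hs'))
    linarith [h.mul_exp_le_linearPart_add hκ0.le hV hs', h.linearPart_le_deriv hs']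

end ExponentialGrowth

end IsMoment

/-- The multiplier `exp (ν₁ (1 + t)^(1 - β) / (1 - β))` of the scattering damping
`ν₁ (1 + t)^(-β)`. -/
noncomputable def damp (ν₁ β t : ℝ) : ℝ := Real.exp (ν₁ * ((1 + t) ^ (1 - β) / (1 - β)))

section Damp

variable {ν₁ β t : ℝ}

lemma damp_zero (ν₁ β : ℝ) : damp ν₁ β 0 = Real.exp (ν₁ / (1 - β)) := by
  rw [damp, add_zero, Real.one_rpow, mul_one_div]

lemma hasDerivAt_damp (hβ : β ≠ 1) (ht : 0 < 1 + t) :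
    HasDerivAt (damp ν₁ β) (ν₁ / (1 + t) ^ β * damp ν₁ β t) t := by
  have hpow := ((hasDerivAt_id t).const_add 1).rpow_const (p := 1 - β) (Or.inl ht.ne')
  refine (((hpow.div_const (1 - β)).const_mul ν₁).exp).congr_deriv ?_
  have hβ' : 1 - β ≠ 0 := sub_ne_zero.2 hβ.symm
  rw [id_eq, sub_sub_cancel_left, Real.rpow_neg ht.le, damp]
  field_simp

lemma isMultiplier_damp (hν₁ : 0 ≤ ν₁) (hβ : 1 < β) : IsMultiplier (damp ν₁ β) where
  pos := Real.exp_pos _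
  differentiableAt t ht := (hasDerivAt_damp hβ.ne' (by linarith)).differentiableAt
  deriv_nonneg t ht := by
    rw [(hasDerivAt_damp hβ.ne' (by linarith)).deriv]
    exact mul_nonneg (div_nonneg hν₁ (Real.rpow_nonneg (by linarith) _)) (Real.exp_pos _).le
  le_one t ht := Real.exp_le_one_iff.2 <| mul_nonpos_of_nonneg_of_nonpos hν₁ <|
    div_nonpos_of_nonneg_of_nonpos (Real.rpow_nonneg (by linarith) _) (by linarith)

end Damp

/-! ### Blow-up from superlinear growth -/

section Superlinear

variable {F : ℝ → ℝ} {p K τ X : ℝ}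

/-- The steps `r = τ / 2 ^ (j + 1)` stay inside `[τ, 2τ]`; the loss `r ^ 2 ~ 4 ^ (-j)` is
compensated by the gain `(X ^ j) ^ (p - 1) = 4 ^ j`. -/
lemma mul_pow_le_of_superlinear (hτ : 0 ≤ τ) (hF : 0 < F τ) (hp : 0 ≤ p) (hK : 0 ≤ K) (hX0 : 0 < X)
    (hX : X ^ (p - 1) = 4)
    (hstep : ∀ t r, τ ≤ t → 0 ≤ r → t + r ≤ 2 * τ → K * r ^ 2 * F t ^ p ≤ F (t + r))
    (hbig : 4 * X ≤ K * τ ^ 2 * F τ ^ (p - 1)) (j : ℕ) :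
    F τ * X ^ j ≤ F (τ * (2 - (1 / 2) ^ j)) := by
  induction j with
  | zero => norm_num
  | succ j ih =>
    have hj : (1 / 2 : ℝ) ^ j ≤ 1 := pow_le_one₀ (by norm_num) (by norm_num)
    have hnext : τ * (2 - (1 / 2) ^ j) + τ * (1 / 2) ^ (j + 1)
        = τ * (2 - (1 / 2) ^ (j + 1)) := by ring
    have hrpow : (F τ * X ^ j) ^ p = F τ * X ^ j * (F τ ^ (p - 1) * 4 ^ j) := by
      have hpos : 0 < F τ * X ^ j := by positivity
      rw [show p = 1 + (p - 1) by ring, Real.rpow_add hpos, Real.rpow_one,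
        Real.mul_rpow hF.le (by positivity), ← Real.rpow_pow_comm hX0.le, add_sub_cancel_left, hX]
    have hhalf : ((1 / 2 : ℝ) ^ (j + 1)) ^ 2 * 4 ^ j = 1 / 4 := by
      rw [← pow_mul, mul_comm (j + 1), pow_mul, pow_succ, mul_right_comm, ← mul_pow]
      norm_num
    calc F τ * X ^ (j + 1) = F τ * X ^ j * (4 * X) * (1 / 4) := by ring
      _ ≤ F τ * X ^ j * (K * τ ^ 2 * F τ ^ (p - 1)) * (1 / 4) := by gcongr
      _ = K * (τ * (1 / 2) ^ (j + 1)) ^ 2 * (F τ * X ^ j) ^ p := by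
        rw [hrpow, ← hhalf]
        ring
      _ ≤ K * (τ * (1 / 2) ^ (j + 1)) ^ 2 * F (τ * (2 - (1 / 2) ^ j)) ^ p := by gcongr
      _ ≤ F (τ * (2 - (1 / 2) ^ j) + τ * (1 / 2) ^ (j + 1)) := by
        refine hstep _ _ (by nlinarith) (by positivity) ?_
        rw [hnext]
        nlinarith [show (0 : ℝ) < (1 / 2) ^ (j + 1) by positivity]
      _ = F (τ * (2 - (1 / 2) ^ (j + 1))) := by rw [hnext]

lemma mul_sq_mul_rpow_lt_of_superlinear (hτ : 0 ≤ τ) (hF : 0 < F τ) (hp : 1 < p) (hK : 0 ≤ K)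
    (hmono : MonotoneOn F (Icc τ (2 * τ)))
    (hstep : ∀ t r, τ ≤ t → 0 ≤ r → t + r ≤ 2 * τ → K * r ^ 2 * F t ^ p ≤ F (t + r)) :
    K * τ ^ 2 * F τ ^ (p - 1) < 4 * 4 ^ (1 / (p - 1)) := by
  have hp1 : 0 < p - 1 := by linarith
  have hX : ((4 : ℝ) ^ (1 / (p - 1))) ^ (p - 1) = 4 := by
    rw [← Real.rpow_mul (by norm_num), one_div_mul_cancel hp1.ne', Real.rpow_one]
  by_contra! hbig
  obtain ⟨j, hj⟩ := pow_unbounded_of_one_lt (F (2 * τ) / F τ)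
    (Real.one_lt_rpow (by norm_num : (1 : ℝ) < 4) (one_div_pos.2 hp1))
  rw [div_lt_iff₀' hF] at hj
  have hj0 : (0 : ℝ) ≤ (1 / 2) ^ j := by positivity
  have hj1 : (1 / 2 : ℝ) ^ j ≤ 1 := pow_le_one₀ (by norm_num) (by norm_num)
  have hle : F (τ * (2 - (1 / 2) ^ j)) ≤ F (2 * τ) :=
    hmono ⟨by nlinarith, by nlinarith⟩ (right_mem_Icc.2 (by linarith)) (by nlinarith)
  linarith [mul_pow_le_of_superlinear hτ hF (by linarith) hK (by positivity) hX hstep hbig j]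

lemma le_mul_rpow_of_mul_rpow_le {A B M q Γ : ℝ} (hτ : 0 ≤ τ) (hA : 0 < A) (hB : 0 < B)
    (hM : 0 ≤ M) (hΓ : 0 < Γ) (h : A * B ^ q * τ ^ Γ ≤ M) :
    τ ≤ (M / A) ^ (1 / Γ) * B ^ (-(q / Γ)) := by
  have hpow : τ ^ Γ ≤ M / A * B ^ (-q) := by
    rw [Real.rpow_neg hB.le, ← div_eq_mul_inv, div_div, le_div_iff₀' (by positivity)]
    exact h
  calc τ = (τ ^ Γ) ^ (1 / Γ) := by
        rw [← Real.rpow_mul hτ, mul_one_div_cancel hΓ.ne', Real.rpow_one]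
    _ ≤ (M / A * B ^ (-q)) ^ (1 / Γ) := by gcongr
    _ = (M / A) ^ (1 / Γ) * B ^ (-(q / Γ)) := by
      rw [Real.mul_rpow (by positivity) (by positivity), ← Real.rpow_mul hB.le]
      ring_nf

lemma time_le_of_superlinear {c b a B t₁ : ℝ} (hc : 0 < c) (hb : 0 ≤ b)
    (hp : 1 < p) (hB : 0 < B) (hΓ : 0 < 2 - b + a * (p - 1)) (ht₁ : 4 < t₁)
    (hmono : MonotoneOn F (Icc 0 t₁))
    (hstep : ∀ t r, 1 ≤ t → 0 ≤ r → t + r ≤ t₁ →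
      c * (1 + (t + r)) ^ (-b) * r ^ 2 * F t ^ p ≤ F (t + r))
    (hlow : ∀ t ∈ Icc 2 t₁, B * t ^ a ≤ F t) :
    t₁ ≤ 2 * ((4 * 4 ^ (1 / (p - 1)) / (c * 4 ^ (-b))) ^ (1 / (2 - b + a * (p - 1)))
      * B ^ (-((p - 1) / (2 - b + a * (p - 1))))) := by
  obtain ⟨τ, rfl⟩ : ∃ τ, t₁ = 2 * τ := ⟨t₁ / 2, by ring⟩
  have hτ : 2 < τ := by linarith
  have hτ0 : 0 < τ := by linarith
  have hFτ := hlow τ ⟨hτ.le, by linarith⟩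
  have hsuper := mul_sq_mul_rpow_lt_of_superlinear (F := F) (K := c * (4 * τ) ^ (-b)) hτ0.le
    (lt_of_lt_of_le (by positivity) hFτ) hp (by positivity)
    (hmono.mono (Icc_subset_Icc_left hτ0.le)) fun t r ht hr htr => by
      have hF : 0 ≤ F t := le_trans (mul_nonneg hB.le (Real.rpow_nonneg (by linarith) _))
        (hlow t ⟨by linarith, by linarith⟩)
      have hpow : (4 * τ) ^ (-b) ≤ (1 + (t + r)) ^ (-b) :=
        Real.rpow_le_rpow_of_nonpos (by linarith) (by linarith) (by linarith)
      refine le_trans ?_ (hstep t r (by linarith) hr htr)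
      gcongr
  refine mul_le_mul_of_nonneg_left (le_mul_rpow_of_mul_rpow_le hτ0.le (by positivity) hB
    (by positivity) hΓ (le_trans ?_ hsuper.le)) two_pos.le
  have hτpow : τ ^ (2 - b + a * (p - 1)) = τ ^ (-b) * τ ^ 2 * (τ ^ a) ^ (p - 1) := by
    rw [← Real.rpow_two, ← Real.rpow_add hτ0, ← Real.rpow_mul hτ0.le, ← Real.rpow_add hτ0,
      neg_add_eq_sub]
  calc c * 4 ^ (-b) * B ^ (p - 1) * τ ^ (2 - b + a * (p - 1))
      = c * (4 * τ) ^ (-b) * τ ^ 2 * (B * τ ^ a) ^ (p - 1) := by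
        rw [hτpow, Real.mul_rpow (by norm_num) hτ0.le, Real.mul_rpow hB.le (by positivity)]
        ring
    _ ≤ c * (4 * τ) ^ (-b) * τ ^ 2 * F τ ^ (p - 1) := by
        gcongr

end Superlinear

/-! ### Exponential integrals -/

section Strip

variable {n : ℕ}

lemma lintegral_prod_pi (f : Fin n → ℝ → ℝ≥0∞) (hf : ∀ i, Measurable (f i)) :
    ∫⁻ x : Fin n → ℝ, ∏ i, f i (x i) = ∏ i, ∫⁻ t, f i t := by
  induction n with
  | zero => simp [volume_pi]
  | succ n ih =>
    rw [← ((volume_preserving_piFinSuccAbove (fun _ : Fin (n + 1) => ℝ) 0).symm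
      (MeasurableEquiv.piFinSuccAbove _ 0)).lintegral_comp_emb
      (MeasurableEquiv.measurableEmbedding _)]
    simp only [MeasurableEquiv.piFinSuccAbove_symm_apply, Fin.prod_univ_succ,
      Fin.insertNthEquiv, Fin.insertNth_zero, Equiv.coe_fn_mk, Fin.cons_zero, Fin.cons_succ]
    have hm : Measurable fun y : Fin n → ℝ => ∏ i : Fin n, f i.succ (y i) :=
      Finset.measurable_fun_prod _ fun i _ => (hf i.succ).comp (measurable_pi_apply i)
    rw [← ih _ fun i => hf i.succ]
    exact lintegral_prod_mul (hf 0).aemeasurable hm.aemeasurable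

lemma lintegral_prod_repr (b : OrthonormalBasis (Fin n) ℝ (Space n)) (f : Fin n → ℝ → ℝ≥0∞)
    (hf : ∀ i, Measurable (f i)) :
    ∫⁻ x : Space n, ∏ i, f i (b.repr x i) = ∏ i, ∫⁻ t, f i t := by
  have hm : Measurable fun y : Fin n → ℝ => ∏ i, f i (y i) :=
    Finset.measurable_fun_prod _ fun i _ => (hf i).comp (measurable_pi_apply i)
  exact (((PiLp.volume_preserving_ofLp (Fin n)).comp b.measurePreserving_repr).lintegral_comp
    hm).trans (lintegral_prod_pi f hf)

lemma lintegral_exp_neg_mul_sq {c : ℝ} (hc : 0 < c) :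
    ∫⁻ t : ℝ, ENNReal.ofReal (Real.exp (-c * t ^ 2)) = ENNReal.ofReal √(Real.pi / c) := by
  rw [← ofReal_integral_eq_lintegral_ofReal (integrable_exp_neg_mul_sq hc)
    (ae_of_all _ fun _ => (Real.exp_pos _).le), integral_gaussian]

lemma exists_orthonormalBasis_apply_eq (i : Fin n) {e : Space n} (he : ‖e‖ = 1) :
    ∃ b : OrthonormalBasis (Fin n) ℝ (Space n), b i = e := by
  obtain ⟨b, hb⟩ := Orthonormal.exists_orthonormalBasis_extension_of_card_eq (𝕜 := ℝ)
    (E := Space n) (ι := Fin n) (by simp) (v := fun _ => e) (s := {i}) (by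
      rw [orthonormal_subsingleton_iff]
      intro i
      simpa using he)
  exact ⟨b, hb i rfl⟩

lemma lintegral_inner_mul_exp (hn : 1 ≤ n) {e : Space n} (he : ‖e‖ = 1) {c : ℝ} (hc : 0 < c)
    {h : ℝ → ℝ≥0∞} (hh : Measurable h) :
    ∫⁻ x : Space n, h (inner ℝ e x) *
        ENNReal.ofReal (Real.exp (-c * (‖x‖ ^ 2 - inner ℝ e x ^ 2)))
      = (∫⁻ t, h t) * ENNReal.ofReal (√(Real.pi / c) ^ (n - 1)) := by
  obtain ⟨m, rfl⟩ : ∃ m, n = m + 1 := ⟨n - 1, by omega⟩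
  obtain ⟨b, hb⟩ := exists_orthonormalBasis_apply_eq (0 : Fin (m + 1)) he
  set f : Fin (m + 1) → ℝ → ℝ≥0∞ :=
    Fin.cons h fun _ t => ENNReal.ofReal (Real.exp (-c * t ^ 2)) with hf
  have hfm : ∀ i, Measurable (f i) := by
    refine Fin.cases (by simpa only [hf, Fin.cons_zero] using hh) fun j => ?_
    simp only [hf, Fin.cons_succ]
    fun_prop
  calc ∫⁻ x : Space (m + 1), h (inner ℝ e x) *
        ENNReal.ofReal (Real.exp (-c * (‖x‖ ^ 2 - inner ℝ e x ^ 2)))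
      = ∫⁻ x : Space (m + 1), ∏ i, f i (b.repr x i) := by
        refine lintegral_congr fun x => ?_
        have h0 : b.repr x 0 = inner ℝ e x := by rw [b.repr_apply_apply, hb]
        have hnorm : ‖x‖ ^ 2 - inner ℝ e x ^ 2 = ∑ i : Fin m, b.repr x i.succ ^ 2 := by
          rw [← b.repr.norm_map x, EuclideanSpace.norm_sq_eq, Fin.sum_univ_succ, ← h0]
          simp
        simp only [Fin.prod_univ_succ, hnorm, hf, Fin.cons_zero, Fin.cons_succ, h0]
        rw [← ENNReal.ofReal_prod_of_nonneg fun _ _ => (Real.exp_pos _).le, ← Real.exp_sum,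
          Finset.mul_sum]
    _ = ∏ i, ∫⁻ t, f i t := lintegral_prod_repr b f hfm
    _ = (∫⁻ t, h t) * ENNReal.ofReal (√(Real.pi / c) ^ (m + 1 - 1)) := by
        simp only [Fin.prod_univ_succ, hf, Fin.cons_zero, Fin.cons_succ,
          lintegral_exp_neg_mul_sq hc, Finset.prod_const, Finset.card_univ, Fintype.card_fin,
          Nat.add_sub_cancel, ENNReal.ofReal_pow (Real.sqrt_nonneg _)]

lemma exists_unit_smul (hn : 1 ≤ n) (x : Space n) : ∃ e : Space n, ‖e‖ = 1 ∧ x = ‖x‖ • e := by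
  by_cases hx : x = 0
  · exact ⟨EuclideanSpace.single ⟨0, hn⟩ 1, by simp, by simp [hx]⟩
  · have : ‖x‖ ≠ 0 := norm_ne_zero_iff.2 hx
    exact ⟨‖x‖⁻¹ • x, by simp [norm_smul, this], by simp [smul_smul, this]⟩

lemma abs_inner_le_norm_of_unit {e : Space n} (he : ‖e‖ = 1) (x : Space n) :
    |inner ℝ e x| ≤ ‖x‖ := by
  simpa only [he, one_mul] using abs_real_inner_le_norm e x

lemma sqrt_mul_pow_eq (hn : 1 ≤ n) {c r : ℝ} (hc : 0 ≤ c) (hr : 0 ≤ r) :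
    √(c * r) ^ (n - 1) = √c ^ (n - 1) * r ^ (((n : ℝ) - 1) / 2) := by
  rw [Real.sqrt_mul hc, mul_pow, Real.sqrt_eq_rpow r, ← Real.rpow_natCast (r ^ (1 / 2 : ℝ)),
    ← Real.rpow_mul hr, Nat.cast_sub hn, Nat.cast_one]
  congr 2
  ring

end Strip

section FrequencyBounds

lemma mul_sub_mul_le_of_le_two {a r y ρ : ℝ} (ha₀ : 0 ≤ a) (ha : a ≤ ρ) (hr : r ≤ 2)
    (hy : |y| ≤ r) : a * y - r * ρ ≤ -(ρ / 4) * (r ^ 2 - y ^ 2) := by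
  have hρ : 0 ≤ ρ := ha₀.trans ha
  have hr0 : 0 ≤ r := (abs_nonneg y).trans hy
  have hyr := (abs_le.1 hy).2
  have hay : a * y ≤ ρ * max y 0 := by
    rcases le_total y 0 with h | h
    · simpa only [max_eq_right h, mul_zero] using mul_nonpos_of_nonneg_of_nonpos ha₀ h
    · simpa only [max_eq_left h] using mul_le_mul_of_nonneg_right ha h
  have hmax : max y 0 ≤ r - (r ^ 2 - y ^ 2) / 4 := by
    refine max_le ?_ ?_ <;> nlinarith
  nlinarith [mul_le_mul_of_nonneg_left hmax hρ]

lemma mul_sub_mul_le_of_one_le {k r y ρ : ℝ} (hk : 1 ≤ k) (hρ : 0 < ρ) (hr : r ≤ ρ)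
    (hy : |y| ≤ r) :
    k * y - k * ρ ≤ (1 / 2 * y - ρ / 2) + -(1 / (4 * ρ)) * (r ^ 2 - y ^ 2) := by
  have hyρ : y ≤ ρ := ((le_abs_self y).trans hy).trans hr
  have hr0 : 0 ≤ r := (abs_nonneg y).trans hy
  have hquad : 1 / (4 * ρ) * (r ^ 2 - y ^ 2) ≤ (ρ - y) / 2 := by
    rw [one_div_mul_eq_div, div_le_iff₀ (by positivity)]
    nlinarith [pow_le_pow_left₀ hr0 hr 2, sq_nonneg (ρ - y)]
  nlinarith [mul_nonneg (sub_nonneg.2 hk) (sub_nonneg.2 hyρ)]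

lemma lintegral_Iic_exp_half (ρ : ℝ) :
    ∫⁻ t in Iic ρ, ENNReal.ofReal (Real.exp (1 / 2 * t - ρ / 2)) = ENNReal.ofReal 2 := by
  have hexp : ∀ t : ℝ, Real.exp (1 / 2 * t - ρ / 2) = Real.exp (-(ρ / 2)) * Real.exp (1 / 2 * t) :=
    fun t => by rw [← Real.exp_add, sub_eq_neg_add]
  simp_rw [hexp]
  rw [← ofReal_integral_eq_lintegral_ofReal
      ((integrableOn_exp_mul_Iic (by norm_num) ρ).const_mul _) (ae_of_all _ fun _ => by positivity),
    integral_const_mul, integral_exp_mul_Iic (by norm_num), ← mul_div_assoc, ← Real.exp_add,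
    one_div_mul_eq_div, neg_add_cancel, Real.exp_zero]
  norm_num

variable {n : ℕ} {ρ : ℝ}

lemma lintegral_exp_inner_sub_le (hn : 1 ≤ n) (hρ : 0 < ρ) {x : Space n} (hx : ‖x‖ ≤ ρ)
    {D : Set (Space n)} (hDm : MeasurableSet D) (hD : ∀ ξ ∈ D, ‖ξ‖ ≤ 2) :
    ∫⁻ ξ in D, ENNReal.ofReal (Real.exp (inner ℝ x ξ - ‖ξ‖ * ρ))
      ≤ ENNReal.ofReal (4 * √(4 * Real.pi) ^ (n - 1) * ρ ^ (-(((n : ℝ) - 1) / 2))) := by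
  obtain ⟨e, he, hxe⟩ := exists_unit_smul hn x
  have hinner : ∀ ξ, inner ℝ x ξ = ‖x‖ * inner ℝ e ξ := fun ξ => by
    conv_lhs => rw [hxe]
    rw [real_inner_smul_left]
  set h : ℝ → ℝ≥0∞ := (Icc (-2 : ℝ) 2).indicator 1 with hh
  have hint : ∫⁻ t, h t = ENNReal.ofReal 4 := by
    rw [hh, lintegral_indicator_one measurableSet_Icc, Real.volume_Icc]
    norm_num
  calc ∫⁻ ξ in D, ENNReal.ofReal (Real.exp (inner ℝ x ξ - ‖ξ‖ * ρ))
      ≤ ∫⁻ ξ in D, h (inner ℝ e ξ) *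
          ENNReal.ofReal (Real.exp (-(ρ / 4) * (‖ξ‖ ^ 2 - inner ℝ e ξ ^ 2))) := by
        refine setLIntegral_mono' hDm fun ξ hξ => ?_
        have hy := abs_inner_le_norm_of_unit he ξ
        rw [hh, indicator_of_mem (mem_Icc.2 (abs_le.1 (hy.trans (hD ξ hξ)))), Pi.one_apply,
          one_mul, hinner]
        exact ENNReal.ofReal_le_ofReal <| Real.exp_le_exp.2 <|
          mul_sub_mul_le_of_le_two (norm_nonneg x) hx (hD ξ hξ) hy
    _ ≤ ∫⁻ ξ, h (inner ℝ e ξ) *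
          ENNReal.ofReal (Real.exp (-(ρ / 4) * (‖ξ‖ ^ 2 - inner ℝ e ξ ^ 2))) :=
        setLIntegral_le_lintegral _ _
    _ = ENNReal.ofReal (4 * √(4 * Real.pi * ρ⁻¹) ^ (n - 1)) := by
        rw [lintegral_inner_mul_exp hn he (by positivity)
          (measurable_one.indicator measurableSet_Icc), hint, ← ENNReal.ofReal_mul (by norm_num),
          show Real.pi / (ρ / 4) = 4 * Real.pi * ρ⁻¹ by field_simp]
    _ = _ := by
        rw [sqrt_mul_pow_eq hn (by positivity) (by positivity), Real.inv_rpow hρ.le,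
          ← Real.rpow_neg hρ.le, mul_assoc]

lemma setIntegral_exp_inner_sub_le (hn : 1 ≤ n) (hρ : 0 < ρ) {ξ : Space n} (hξ : 1 ≤ ‖ξ‖) :
    ∫ x in closedBall (0 : Space n) ρ, Real.exp (inner ℝ x ξ - ‖ξ‖ * ρ)
      ≤ 2 * √(4 * Real.pi) ^ (n - 1) * ρ ^ (((n : ℝ) - 1) / 2) := by
  obtain ⟨e, he, hξe⟩ := exists_unit_smul hn ξ
  have hinner : ∀ x, inner ℝ x ξ = ‖ξ‖ * inner ℝ e x := fun x => by
    conv_lhs => rw [hξe]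
    rw [real_inner_smul_right, real_inner_comm]
  set h : ℝ → ℝ≥0∞ :=
    (Iic ρ).indicator fun t => ENNReal.ofReal (Real.exp (1 / 2 * t - ρ / 2)) with hh
  have hint : ∫⁻ t, h t = ENNReal.ofReal 2 := by
    rw [hh, lintegral_indicator measurableSet_Iic, lintegral_Iic_exp_half]
  rw [integral_eq_lintegral_of_nonneg_ae (ae_of_all _ fun _ => (Real.exp_pos _).le)
    (by fun_prop : Continuous fun x : Space n =>
      Real.exp (inner ℝ x ξ - ‖ξ‖ * ρ)).aestronglyMeasurable]
  refine ENNReal.toReal_le_of_le_ofReal (by positivity) ?_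
  calc ∫⁻ x in closedBall (0 : Space n) ρ,
        ENNReal.ofReal (Real.exp (inner ℝ x ξ - ‖ξ‖ * ρ))
      ≤ ∫⁻ x in closedBall (0 : Space n) ρ, h (inner ℝ e x) *
          ENNReal.ofReal (Real.exp (-(1 / (4 * ρ)) * (‖x‖ ^ 2 - inner ℝ e x ^ 2))) := by
        refine setLIntegral_mono' isClosed_closedBall.measurableSet fun x hx => ?_
        rw [mem_closedBall_zero_iff] at hx
        have hy := abs_inner_le_norm_of_unit he x
        rw [hh, indicator_of_mem (mem_Iic.2 (((le_abs_self _).trans hy).trans hx)),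
          ← ENNReal.ofReal_mul (Real.exp_pos _).le, ← Real.exp_add, hinner]
        exact ENNReal.ofReal_le_ofReal <| Real.exp_le_exp.2 <| mul_sub_mul_le_of_one_le hξ hρ hx hy
    _ ≤ ∫⁻ x, h (inner ℝ e x) *
          ENNReal.ofReal (Real.exp (-(1 / (4 * ρ)) * (‖x‖ ^ 2 - inner ℝ e x ^ 2))) :=
        setLIntegral_le_lintegral _ _
    _ = ENNReal.ofReal (2 * √(4 * Real.pi * ρ) ^ (n - 1)) := by
        rw [lintegral_inner_mul_exp hn he (by positivity)
          (Measurable.indicator (by fun_prop) measurableSet_Iic), hint,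
          ← ENNReal.ofReal_mul (by norm_num),
          show Real.pi / (1 / (4 * ρ)) = 4 * Real.pi * ρ by field_simp]
    _ = _ := by rw [sqrt_mul_pow_eq hn (by positivity) hρ.le, mul_assoc]

end FrequencyBounds

/-! ### Moments of energy solutions -/

/-- A cut-off exponential `e^{⟨x, ξ⟩}`, used as the spatial factor of test functions. The cut-off is
needed only because test functions have compact support: it equals one where the solution lives. -/
noncomputable def expTest {n : ℕ} (η : ContDiffBump (0 : Space n)) (ξ x : Space n) : ℝ :=
  η x * Real.exp (inner ℝ x ξ)

section ExpTest

variable {n : ℕ} (η : ContDiffBump (0 : Space n)) (ξ : Space n)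

lemma contDiff_expTest : ContDiff ℝ ∞ (expTest η ξ) :=
  η.contDiff.mul (contDiff_id.inner ℝ contDiff_const).exp

lemma hasCompactSupport_expTest : HasCompactSupport (expTest η ξ) :=
  η.hasCompactSupport.mul_right

lemma memLp_expTest : MemLp (expTest η ξ) 2 volume :=
  (contDiff_expTest η ξ).continuous.memLp_of_hasCompactSupport (hasCompactSupport_expTest η ξ)

lemma expTest_nonneg (x : Space n) : 0 ≤ expTest η ξ x := mul_nonneg η.nonneg (Real.exp_pos _).le

lemma integrable_mul_expTest (u : L2 n) : Integrable fun x => u x * expTest η ξ x :=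
  (Lp.memLp u).integrable_mul (memLp_expTest η ξ)

/-- The moment `∫ u(x) e^{⟨x, ξ⟩} dx` of `u ∈ L²`, with the cut-off `η`. -/
noncomputable def moment : L2 n →L[ℝ] ℝ := innerSL ℝ ((memLp_expTest η ξ).toLp _)

lemma moment_apply (u : L2 n) : moment η ξ u = ∫ x, u x * expTest η ξ x := by
  rw [moment, innerSL_apply_apply, L2.inner_def]
  refine integral_congr_ae ?_
  filter_upwards [(memLp_expTest η ξ).coeFn_toLp] with x hx
  rw [hx]
  simp

lemma moment_nonneg {u : L2 n} (hu : 0 ≤ u) : 0 ≤ moment η ξ u := by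
  rw [moment_apply]
  refine integral_nonneg_of_ae ?_
  filter_upwards [(Lp.coeFn_nonneg u).2 hu] with x hx
  exact mul_nonneg hx (expTest_nonneg η ξ x)

variable {η ξ}

lemma expTest_eq {x : Space n} (hx : ‖x‖ ≤ η.rIn) : expTest η ξ x = Real.exp (inner ℝ x ξ) := by
  rw [expTest, η.one_of_mem_closedBall (by rwa [mem_closedBall_zero_iff]), one_mul]

lemma hasFDerivAt_exp_inner (x : Space n) :
    HasFDerivAt (fun y : Space n => Real.exp (inner ℝ y ξ))
      (Real.exp (inner ℝ x ξ) • innerSL ℝ ξ) x := by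
  have h : HasFDerivAt (fun y : Space n => inner ℝ ξ y) (innerSL ℝ ξ) x :=
    (innerSL ℝ ξ).hasFDerivAt
  simpa only [real_inner_comm] using h.exp

lemma fderiv_expTest {x : Space n} (hx : ‖x‖ < η.rIn) (v : Space n) :
    fderiv ℝ (expTest η ξ) x v = inner ℝ ξ v * Real.exp (inner ℝ x ξ) := by
  have h : expTest η ξ =ᶠ[𝓝 x] fun y => Real.exp (inner ℝ y ξ) := by
    filter_upwards [(isOpen_lt continuous_norm continuous_const).mem_nhds hx] with y hy
    exact expTest_eq hy.le
  rw [h.fderiv_eq, (hasFDerivAt_exp_inner x).fderiv]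
  simp [mul_comm]

lemma fderiv_fderiv_expTest {x : Space n} (hx : ‖x‖ < η.rIn) (v : Space n) :
    fderiv ℝ (fun y => fderiv ℝ (expTest η ξ) y v) x v = inner ℝ ξ v ^ 2 * expTest η ξ x := by
  have h : (fun y => fderiv ℝ (expTest η ξ) y v)
      =ᶠ[𝓝 x] fun y => inner ℝ ξ v * Real.exp (inner ℝ y ξ) := by
    filter_upwards [(isOpen_lt continuous_norm continuous_const).mem_nhds hx] with y hy
    exact fderiv_expTest hy v
  rw [h.fderiv_eq, ((hasFDerivAt_exp_inner x).const_mul _).fderiv, expTest_eq hx.le]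
  simp only [smul_eq_mul, smul_apply, innerSL_apply_apply]
  ring

end ExpTest

section Gradient

variable {n : ℕ} {ψ : Space n → ℝ}

lemma fderiv_apply_eq_sum (b : OrthonormalBasis (Fin n) ℝ (Space n)) (x v : Space n) :
    fderiv ℝ ψ x v = ∑ i, inner ℝ v (b i) * fderiv ℝ ψ x (b i) := by
  conv_lhs => rw [← b.sum_repr v, map_sum]
  refine Finset.sum_congr rfl fun i _ => ?_
  rw [map_smul, b.repr_apply_apply, smul_eq_mul, real_inner_comm]

lemma contDiff_fderiv_apply (hψ : ContDiff ℝ ∞ ψ) (v : Space n) :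
    ContDiff ℝ ∞ fun x => fderiv ℝ ψ x v :=
  (hψ.fderiv_right (by simp)).clm_apply contDiff_const

lemma integrable_inner_mul_fderiv (hψ : ContDiff ℝ ∞ ψ) (hc : HasCompactSupport ψ) (G : L2Vec n)
    (v : Space n) : Integrable fun x => inner ℝ (G x) v * fderiv ℝ ψ x v :=
  integrable_inner_mul_test G v (contDiff_fderiv_apply hψ v).continuous (hc.fderiv_apply ℝ v)

lemma integrable_fderiv_apply (hψ : ContDiff ℝ ∞ ψ) (hc : HasCompactSupport ψ) (G : L2Vec n) :
    Integrable fun x => fderiv ℝ ψ x (G x) := by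
  rw [funext fun x => fderiv_apply_eq_sum (EuclideanSpace.basisFun (Fin n) ℝ) x (G x)]
  exact integrable_finsetSum _ fun i _ => integrable_inner_mul_fderiv hψ hc G _

lemma integral_fderiv_grad (hψ : ContDiff ℝ ∞ ψ) (hc : HasCompactSupport ψ) (u : H1 n)
    (b : OrthonormalBasis (Fin n) ℝ (Space n)) :
    ∫ x, fderiv ℝ ψ x (grad u x)
      = -∑ i, ∫ x, fn u x * fderiv ℝ (fun y => fderiv ℝ ψ y (b i)) x (b i) := by
  rw [integral_congr_ae (.of_forall fun x => fderiv_apply_eq_sum b x (grad u x)),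
    integral_finsetSum _ fun i _ => integrable_inner_mul_fderiv hψ hc (grad u) (b i),
    ← Finset.sum_neg_distrib]
  refine Finset.sum_congr rfl fun i _ => ?_
  exact (neg_eq_iff_eq_neg.2
    (u.2 _ (contDiff_fderiv_apply hψ (b i)) (hc.fderiv_apply ℝ (b i)) (b i))).symm

lemma integral_fderiv_expTest_grad {η : ContDiffBump (0 : Space n)} {ξ : Space n} {u : H1 n}
    {r : ℝ} (hr : r < η.rIn) (hu : ∀ᵐ x : Space n, r < ‖x‖ → fn u x = 0) :
    ∫ x, fderiv ℝ (expTest η ξ) x (grad u x) = -(‖ξ‖ ^ 2 * moment η ξ (fn u)) := by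
  set b := EuclideanSpace.basisFun (Fin n) ℝ
  have hsecond : ∀ i, ∫ x, fn u x * fderiv ℝ (fun y => fderiv ℝ (expTest η ξ) y (b i)) x (b i)
      = inner ℝ ξ (b i) ^ 2 * moment η ξ (fn u) := by
    intro i
    rw [moment_apply, ← integral_const_mul]
    refine integral_congr_ae ?_
    filter_upwards [hu] with x hx
    rcases lt_or_ge r ‖x‖ with hxr | hxr
    · rw [hx hxr, zero_mul, zero_mul, mul_zero]
    · rw [fderiv_fderiv_expTest (hxr.trans_lt hr), mul_left_comm]
  have hnorm : ∑ i, inner ℝ ξ (b i) ^ 2 = ‖ξ‖ ^ 2 := by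
    simpa only [Real.norm_eq_abs, sq_abs] using b.sum_sq_norm_inner_left ξ
  rw [integral_fderiv_grad (contDiff_expTest η ξ) (hasCompactSupport_expTest η ξ) u b]
  simp_rw [hsecond]
  rw [← Finset.sum_mul, hnorm]

end Gradient

section TimeInterval

variable {T : ℝ≥0∞} {t₁ t : ℝ}

lemma Icc_subset_timeInterval (hT : ENNReal.ofReal t₁ < T) : Icc 0 t₁ ⊆ timeInterval T :=
  fun _ ht => ⟨ht.1, (ENNReal.ofReal_le_ofReal ht.2).trans_lt hT⟩

lemma timeInterval_mem_nhds (hT : ENNReal.ofReal t₁ < T) (ht : t ∈ Ioo 0 t₁) :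
    timeInterval T ∈ 𝓝 t :=
  mem_of_superset (Icc_mem_nhds ht.1 ht.2) (Icc_subset_timeInterval hT)

lemma uniqueDiffOn_timeInterval (ht₁ : 0 < t₁) (hT : ENNReal.ofReal t₁ < T) :
    UniqueDiffOn ℝ (timeInterval T) := by
  refine uniqueDiffOn_convex (OrdConnected.convex ⟨fun x hx y hy z hz => ?_⟩)
    ⟨t₁ / 2, mem_interior_iff_mem_nhds.2 (timeInterval_mem_nhds hT ⟨?_, ?_⟩)⟩
  · exact ⟨hx.1.trans hz.1, (ENNReal.ofReal_le_ofReal hz.2).trans_lt hy.2⟩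
  · linarith
  · linarith

lemma isTestFunction_mul {n : ℕ} {a : ℝ → ℝ} {ψ : Space n → ℝ} (ha : ContDiff ℝ ∞ a)
    (hac : HasCompactSupport a) (haT : ∀ t ∈ tsupport a, ENNReal.ofReal t < T)
    (hψ : ContDiff ℝ ∞ ψ) (hψc : HasCompactSupport ψ) :
    IsTestFunction T fun z : ℝ × Space n => a z.1 * ψ z.2 := by
  have hsupp : Function.support (fun z : ℝ × Space n => a z.1 * ψ z.2) ⊆ tsupport a ×ˢ tsupport ψ :=
    fun z hz => ⟨subset_tsupport a (left_ne_zero_of_mul hz),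
      subset_tsupport ψ (right_ne_zero_of_mul hz)⟩
  refine ⟨(ha.comp contDiff_fst).mul (hψ.comp contDiff_snd),
    HasCompactSupport.of_support_subset_isCompact (hac.prod hψc) hsupp, fun z hz => haT _ ?_⟩
  exact (closure_minimal hsupp (hac.prod hψc).isClosed hz).1

lemma exists_timeCutoff {m : ℝ → ℝ} (hm : ∀ t, -1 < t → ContDiffAt ℝ ∞ m t) (ht₁ : 0 < t₁)
    (hT : ENNReal.ofReal t₁ < T) :
    ∃ a : ℝ → ℝ, ContDiff ℝ ∞ a ∧ HasCompactSupport a ∧ (∀ t ∈ tsupport a, ENNReal.ofReal t < T) ∧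
      ∀ s ∈ Icc 0 t₁, a =ᶠ[𝓝 s] m := by
  obtain ⟨t₂, -, ht₁₂, ht₂⟩ := ENNReal.lt_iff_exists_real_btwn.1 hT
  rw [ENNReal.ofReal_lt_ofReal_iff_of_nonneg ht₁.le] at ht₁₂
  obtain ⟨e, he, he₁, he₂⟩ : ∃ e : ℝ, 0 < e ∧ e < 1 ∧ e ≤ t₂ - t₁ :=
    ⟨min (1 / 2) (t₂ - t₁), lt_min (by norm_num) (by linarith),
      (min_le_left _ _).trans_lt (by norm_num), min_le_right _ _⟩
  let χ : ContDiffBump (t₁ / 2) := ⟨t₁ / 2 + e / 2, t₁ / 2 + e, by linarith, by linarith⟩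
  have hsupp : tsupport (fun t => χ t * m t) ⊆ Icc (-e) (t₁ + e) := by
    refine (tsupport_mul_subset_left (f := χ)).trans (χ.tsupport_eq.trans ?_).subset
    rw [Real.closedBall_eq_Icc]
    congr 1 <;> ring
  refine ⟨fun t => χ t * m t, contMDiff_iff_contDiff.1 (contMDiff_of_tsupport fun t ht => ?_),
    χ.hasCompactSupport.mul_right, fun t ht => ?_, fun s hs => ?_⟩
  · exact (χ.contDiffAt.mul (hm t (by linarith [(hsupp ht).1]))).contMDiffAt
  · exact (ENNReal.ofReal_le_ofReal (by linarith [(hsupp ht).2])).trans_lt ht₂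
  · have hs' : s ∈ ball (t₁ / 2) (t₁ / 2 + e / 2) := by
      rw [Real.ball_eq_Ioo]
      exact ⟨by linarith [hs.1], by linarith [hs.2]⟩
    filter_upwards [χ.eventuallyEq_one_of_mem_ball hs'] with r hr
    rw [hr, Pi.one_apply, one_mul]

end TimeInterval

lemma contDiffAt_damp {ν₁ β t : ℝ} (ht : -1 < t) : ContDiffAt ℝ ∞ (damp ν₁ β) t := by
  have hbase : ContDiffAt ℝ ∞ (fun s : ℝ => (1 + s) ^ (1 - β)) t :=
    (contDiffAt_const.add contDiffAt_id).rpow_const_of_ne (by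
      rw [id_eq]
      linarith)
  exact ((hbase.div_const _).const_smul ν₁).exp

section EnergySolution

variable {n : ℕ} {ν₁ ν₂ β p ε R t₁ : ℝ} {f : H1 n} {g : L2 n} {T : ℝ≥0∞} {w : ℝ → H1 n}

lemma continuousOn_moment (hw : IsEnergySolution ν₁ ν₂ β p ε f g T w)
    (hT : ENNReal.ofReal t₁ < T) (η : ContDiffBump (0 : Space n)) (ξ : Space n) :
    ContinuousOn (fun t => moment η ξ (fn (w t))) (Icc 0 t₁) :=
  (moment η ξ).continuous.comp_continuousOn
    (hw.contDiffOn.continuousOn.mono (Icc_subset_timeInterval hT))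

lemma continuousOn_moment_timeDeriv (hw : IsEnergySolution ν₁ ν₂ β p ε f g T w) (ht₁ : 0 < t₁)
    (hT : ENNReal.ofReal t₁ < T) (η : ContDiffBump (0 : Space n)) (ξ : Space n) :
    ContinuousOn (fun t => moment η ξ (timeDeriv T w t)) (Icc 0 t₁) :=
  (moment η ξ).continuous.comp_continuousOn ((hw.contDiffOn.continuousOn_derivWithin
    (uniqueDiffOn_timeInterval ht₁ hT) le_rfl).mono (Icc_subset_timeInterval hT))

lemma hasDerivAt_moment (hw : IsEnergySolution ν₁ ν₂ β p ε f g T w) (hT : ENNReal.ofReal t₁ < T)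
    (η : ContDiffBump (0 : Space n)) (ξ : Space n) {t : ℝ} (ht : t ∈ Ioo 0 t₁) :
    HasDerivAt (fun t => moment η ξ (fn (w t))) (moment η ξ (timeDeriv T w t)) t :=
  (moment η ξ).hasFDerivAt.comp_hasDerivAt t
    ((hw.contDiffOn.differentiableOn one_ne_zero _
      (Icc_subset_timeInterval hT (Ioo_subset_Icc_self ht))).hasDerivWithinAt.hasDerivAt
      (timeInterval_mem_nhds hT ht))

lemma moment_init (hw : IsEnergySolution ν₁ ν₂ β p ε f g T w) (η : ContDiffBump (0 : Space n))
    (ξ : Space n) : moment η ξ (fn (w 0)) = ε * moment η ξ (fn f) := by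
  rw [hw.init]
  exact map_smul _ _ _

lemma moment_init_deriv (hw : IsEnergySolution ν₁ ν₂ β p ε f g T w)
    (η : ContDiffBump (0 : Space n)) (ξ : Space n) :
    moment η ξ (timeDeriv T w 0) = ε * moment η ξ g := by
  rw [hw.init_deriv, map_smul, smul_eq_mul]

lemma integral_deriv_term_add_grad_term {η : ContDiffBump (0 : Space n)} {ξ : Space n} {u : H1 n}
    {r : ℝ} (hr : r < η.rIn) (hu : ∀ᵐ x : Space n, r < ‖x‖ → fn u x = 0) (v : L2 n)
    {a : ℝ → ℝ} {a' s : ℝ} (ha : HasDerivAt a a' s) :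
    ∫ x, (-(v x * deriv (fun r => a r * expTest η ξ x) s)
        + fderiv ℝ (fun y => a s * expTest η ξ y) x (grad u x))
      = -(a' * moment η ξ v) - a s * (‖ξ‖ ^ 2 * moment η ξ (fn u)) := by
  have hd : ∀ x, deriv (fun r => a r * expTest η ξ x) s = a' * expTest η ξ x :=
    fun x => (ha.mul_const _).deriv
  have hfd : ∀ x, fderiv ℝ (fun y => a s * expTest η ξ y) x = a s • fderiv ℝ (expTest η ξ) x :=
    fun x => fderiv_const_mul ((contDiff_expTest η ξ).differentiable (by simp) x) _
  simp_rw [hd, hfd, smul_apply, smul_eq_mul, mul_left_comm (v _)]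
  have htime : Integrable fun x => -(a' * (v x * expTest η ξ x)) :=
    ((integrable_mul_expTest η ξ v).const_mul a').neg
  have hspace := (integrable_fderiv_apply (contDiff_expTest η ξ)
    (hasCompactSupport_expTest η ξ) (grad u)).const_mul (a s)
  rw [integral_add htime hspace, integral_neg, integral_const_mul, integral_const_mul,
    integral_fderiv_expTest_grad hr hu, ← moment_apply]
  ring

lemma weak_mul_expTest (hw : IsEnergySolution ν₁ ν₂ β p ε f g T w) (hs : SupportedInCone R T w)
    (hT : ENNReal.ofReal t₁ < T) {η : ContDiffBump (0 : Space n)} (hη : t₁ + R < η.rIn)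
    (ξ : Space n) {a a' : ℝ → ℝ}
    (hφ : IsTestFunction T fun z : ℝ × Space n => a z.1 * expTest η ξ z.2)
    (ha : ∀ s ∈ Icc 0 t₁, HasDerivAt a (a' s) s) {t : ℝ} (ht : t ∈ Icc 0 t₁) :
    a t * moment η ξ (timeDeriv T w t)
        + (∫ s in 0..t, (-(a' s * moment η ξ (timeDeriv T w s))
          - a s * (‖ξ‖ ^ 2 * moment η ξ (fn (w s)))))
        + (∫ s in 0..t, ν₁ / (1 + s) ^ β * (a s * moment η ξ (timeDeriv T w s)))
        + (∫ s in 0..t, ν₂ / (1 + s) ^ 2 * (a s * moment η ξ (fn (w s))))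
      = a 0 * moment η ξ (timeDeriv T w 0)
        + ∫ s in 0..t, a s * ∫ x, |fn (w s) x| ^ p * expTest η ξ x := by
  have hsub : uIcc 0 t ⊆ Icc 0 t₁ := by
    rw [uIcc_of_le ht.1]
    exact Icc_subset_Icc_right ht.2
  have hpair : ∀ (b c : ℝ) (v : L2 n),
      ∫ x, c * v x * (b * expTest η ξ x) = c * (b * moment η ξ v) := by
    intro b c v
    simp_rw [moment_apply, ← integral_const_mul, mul_left_comm b, mul_assoc]
  have hgrad : ∫ s in (0 : ℝ)..t, ∫ x,
        (-(timeDeriv T w s x * deriv (fun r => a r * expTest η ξ x) s)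
        + fderiv ℝ (fun y => a s * expTest η ξ y) x (grad (w s) x))
      = ∫ s in 0..t, (-(a' s * moment η ξ (timeDeriv T w s))
          - a s * (‖ξ‖ ^ 2 * moment η ξ (fn (w s)))) :=
    intervalIntegral.integral_congr fun s hst => integral_deriv_term_add_grad_term
      (by linarith [(hsub hst).2]) (hs s (Icc_subset_timeInterval hT (hsub hst))) _
      (ha s (hsub hst))
  have hsource : ∫ s in (0 : ℝ)..t, ∫ x, |fn (w s) x| ^ p * (a s * expTest η ξ x)
      = ∫ s in 0..t, a s * ∫ x, |fn (w s) x| ^ p * expTest η ξ x := by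
    simp_rw [mul_left_comm _ (a _), integral_const_mul]
  have hweak := hw.weak _ hφ t (Icc_subset_timeInterval hT ht)
  have hfinal := hpair (a t) 1 (timeDeriv T w t)
  simp only [one_mul] at hfinal
  simp only [hpair, hgrad, hfinal, hsource] at hweak
  rwa [moment_init_deriv hw, mul_left_comm]

/-- A time factor with `a' = ν₁ (1 + t)^(-β) a` in the test function makes the damping term
cancel. -/
lemma weak_mul_expTest_of_deriv (hw : IsEnergySolution ν₁ ν₂ β p ε f g T w)
    (hs : SupportedInCone R T w) (ht₁ : 0 < t₁) (hT : ENNReal.ofReal t₁ < T)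
    {η : ContDiffBump (0 : Space n)} (hη : t₁ + R < η.rIn) (ξ : Space n) {a : ℝ → ℝ}
    (hφ : IsTestFunction T fun z : ℝ × Space n => a z.1 * expTest η ξ z.2)
    (ha : ∀ s ∈ Icc 0 t₁, HasDerivAt a (ν₁ / (1 + s) ^ β * a s) s) {t : ℝ} (ht : t ∈ Icc 0 t₁) :
    a t * moment η ξ (timeDeriv T w t) = a 0 * moment η ξ (timeDeriv T w 0)
      + (∫ s in 0..t, a s * ((‖ξ‖ ^ 2 + -ν₂ / (1 + s) ^ 2) * moment η ξ (fn (w s))))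
      + ∫ s in 0..t, a s * ∫ x, |fn (w s) x| ^ p * expTest η ξ x := by
  have hsub : uIcc 0 t ⊆ Icc 0 t₁ := by
    rw [uIcc_of_le ht.1]
    exact Icc_subset_Icc_right ht.2
  have hpos : ∀ s ∈ uIcc 0 t, 0 < 1 + s := fun s hst => by linarith [(hsub hst).1]
  have hca : ContinuousOn a (uIcc 0 t) := fun s hst =>
    (ha s (hsub hst)).continuousAt.continuousWithinAt
  have hcG := (continuousOn_moment hw hT η ξ).mono hsub
  have hcH := (continuousOn_moment_timeDeriv hw ht₁ hT η ξ).mono hsub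
  have hcb : ContinuousOn (fun s : ℝ => ν₁ / (1 + s) ^ β) (uIcc 0 t) :=
    continuousOn_const.div ((by fun_prop : ContinuousOn (fun s : ℝ => 1 + s) _).rpow_const
      fun s hst => Or.inl (hpos s hst).ne') fun s hst => (Real.rpow_pos_of_pos (hpos s hst) β).ne'
  have hcV : ContinuousOn (fun s : ℝ => ν₂ / (1 + s) ^ 2) (uIcc 0 t) :=
    continuousOn_const.div (by fun_prop) fun s hst => (pow_pos (hpos s hst) 2).ne'
  have hcancel : (∫ s in 0..t, a s * ((‖ξ‖ ^ 2 + -ν₂ / (1 + s) ^ 2) * moment η ξ (fn (w s))))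
      = -((∫ s in 0..t, (-(ν₁ / (1 + s) ^ β * a s * moment η ξ (timeDeriv T w s))
          - a s * (‖ξ‖ ^ 2 * moment η ξ (fn (w s)))))
        + (∫ s in 0..t, ν₁ / (1 + s) ^ β * (a s * moment η ξ (timeDeriv T w s)))
        + ∫ s in 0..t, ν₂ / (1 + s) ^ 2 * (a s * moment η ξ (fn (w s)))) := by
    rw [← intervalIntegral.integral_add, ← intervalIntegral.integral_add,
      ← intervalIntegral.integral_neg]
    · congr 1 with s
      ring
    all_goals
      refine ContinuousOn.intervalIntegrable ?_
      fun_prop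
  linarith [weak_mul_expTest hw hs hT hη ξ hφ ha ht]

lemma isMoment_of_isEnergySolution (hw : IsEnergySolution ν₁ ν₂ β p ε f g T w)
    (hs : SupportedInCone R T w) (hν₁ : 0 ≤ ν₁) (hν₂ : ν₂ ≤ 0) (hβ : 1 < β) (hε : 0 ≤ ε)
    (hf : 0 ≤ fn f) (hg : 0 ≤ g) (ht₁ : 0 < t₁) (hT : ENNReal.ofReal t₁ < T)
    {η : ContDiffBump (0 : Space n)} (hη : t₁ + R < η.rIn) (ξ : Space n) :
    IsMoment (damp ν₁ β) (fun t => ‖ξ‖ ^ 2 + -ν₂ / (1 + t) ^ 2) t₁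
      (fun t => moment η ξ (fn (w t))) (fun t => moment η ξ (timeDeriv T w t))
      (fun t => ∫ x, |fn (w t) x| ^ p * expTest η ξ x) := by
  obtain ⟨a, ha, hac, haT, hadamp⟩ :=
    exists_timeCutoff (fun _ h => contDiffAt_damp (ν₁ := ν₁) (β := β) h) ht₁ hT
  have hφ := isTestFunction_mul ha hac haT (contDiff_expTest η ξ) (hasCompactSupport_expTest η ξ)
  have hadamp' : ∀ s ∈ Icc 0 t₁, a s = damp ν₁ β s := fun s hst => (hadamp s hst).eq_of_nhds
  have hderiv : ∀ s ∈ Icc 0 t₁, HasDerivAt a (ν₁ / (1 + s) ^ β * a s) s := fun s hst => by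
    rw [hadamp' s hst]
    exact (hasDerivAt_damp hβ.ne' (by linarith [hst.1])).congr_of_eventuallyEq (hadamp s hst)
  have h0 : (0 : ℝ) ∈ Icc 0 t₁ := left_mem_Icc.2 ht₁.le
  refine ⟨isMultiplier_damp hν₁ hβ, ?_, fun t _ => ?_, ?_, ?_, continuousOn_moment hw hT η ξ,
    fun t ht => hasDerivAt_moment hw hT η ξ ht, fun t _ => integral_nonneg fun x =>
      mul_nonneg (by positivity) (expTest_nonneg η ξ x), ?_, fun t ht => ?_⟩
  · exact continuousOn_const.add (continuousOn_const.div (by fun_prop) fun s hst =>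
      (pow_pos (by linarith [hst.1]) 2).ne')
  · exact add_nonneg (sq_nonneg _) (div_nonneg (neg_nonneg.2 hν₂) (sq_nonneg _))
  · rw [moment_init hw]
    exact mul_nonneg hε (moment_nonneg η ξ hf)
  · rw [moment_init_deriv hw]
    exact mul_nonneg hε (moment_nonneg η ξ hg)
  · refine (hw.integrable _ hφ t₁ (Icc_subset_timeInterval hT (right_mem_Icc.2 ht₁.le))).congr
      fun s hst => ?_
    rw [uIoc_of_le ht₁.le] at hst
    simp_rw [mul_left_comm _ (a s), integral_const_mul, hadamp' s (Ioc_subset_Icc_self hst)]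
  · have hcongr : ∀ F : ℝ → ℝ, ∫ s in 0..t, a s * F s = ∫ s in 0..t, damp ν₁ β s * F s := fun F =>
      intervalIntegral.integral_congr fun s hst => by
        rw [uIcc_of_le ht.1] at hst
        simp only [hadamp' s (Icc_subset_Icc_right ht.2 hst)]
    rw [← hadamp' t ht, ← hadamp' 0 h0, ← hcongr, ← hcongr]
    exact weak_mul_expTest_of_deriv hw hs ht₁ hT hη ξ hφ hderiv ht

end EnergySolution

/-! ### Lower bounds for the nonlinear term -/

lemma memLp_abs_mul_rpow_inv {α : Type*} [MeasurableSpace α] {μ : Measure α} {u φ : α → ℝ}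
    {p : ℝ} (hp : 0 < p) (hφ : 0 ≤ φ) (hu : AEStronglyMeasurable u μ)
    (hφm : AEStronglyMeasurable φ μ) (huφ : Integrable (fun x => |u x| ^ p * φ x) μ) :
    MemLp (fun x => |u x| * φ x ^ p⁻¹) (ENNReal.ofReal p) μ := by
  refine (integrable_norm_rpow_iff (hu.norm.mul
    (hφm.aemeasurable.pow_const _).aestronglyMeasurable) (by simpa) ENNReal.ofReal_ne_top).1
    (huφ.congr (.of_forall fun x => ?_))
  have hx := Real.rpow_nonneg (hφ x) p⁻¹
  simp only [Pi.mul_apply, Real.norm_eq_abs]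
  rw [abs_of_nonneg (mul_nonneg (abs_nonneg _) hx), ENNReal.toReal_ofReal hp.le,
    Real.mul_rpow (abs_nonneg _) hx, Real.rpow_inv_rpow (hφ x) hp.ne']

lemma abs_integral_mul_rpow_le {α : Type*} [MeasurableSpace α] {μ : Measure α} {u φ : α → ℝ}
    {p : ℝ} (hp : 1 < p) (hφ : 0 ≤ φ) (hu : AEStronglyMeasurable u μ) (hφi : Integrable φ μ)
    (huφ : Integrable (fun x => |u x| ^ p * φ x) μ) :
    |∫ x, u x * φ x ∂μ| ^ p ≤ (∫ x, |u x| ^ p * φ x ∂μ) * (∫ x, φ x ∂μ) ^ (p - 1) := by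
  obtain ⟨q, hpq⟩ : ∃ q, p.HolderConjugate q := ⟨_, .conjExponent hp⟩
  have hp0 : 0 < p := hpq.pos
  have hq0 : 0 < q := hpq.symm.pos
  have hsplit : ∀ x, |u x| * φ x ^ p⁻¹ * φ x ^ q⁻¹ = |u x * φ x| := fun x => by
    rw [mul_assoc, ← Real.rpow_add_of_nonneg (hφ x) (by positivity) (by positivity),
      hpq.inv_add_inv_eq_one, Real.rpow_one, abs_mul, abs_of_nonneg (hφ x)]
  have hleft : ∀ x, (|u x| * φ x ^ p⁻¹) ^ p = |u x| ^ p * φ x := fun x => by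
    rw [Real.mul_rpow (abs_nonneg _) (Real.rpow_nonneg (hφ x) _),
      Real.rpow_inv_rpow (hφ x) hp0.ne']
  have hright : ∀ x, (φ x ^ q⁻¹) ^ q = φ x := fun x => Real.rpow_inv_rpow (hφ x) hq0.ne'
  have huL := memLp_abs_mul_rpow_inv hp0 hφ hu hφi.aestronglyMeasurable huφ
  have hφL : MemLp (fun x => φ x ^ q⁻¹) (ENNReal.ofReal q) μ := by
    simpa only [abs_one, one_mul] using memLp_abs_mul_rpow_inv (u := fun _ => 1) hq0 hφ
      aestronglyMeasurable_const hφi.aestronglyMeasurable (by simpa using hφi)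
  have holder := integral_mul_le_Lp_mul_Lq_of_nonneg hpq
    (.of_forall fun x => mul_nonneg (abs_nonneg (u x)) (Real.rpow_nonneg (hφ x) _))
    (.of_forall fun x => Real.rpow_nonneg (hφ x) _) huL hφL
  simp_rw [hsplit, hleft, hright] at holder
  have hA : 0 ≤ ∫ x, |u x| ^ p * φ x ∂μ :=
    integral_nonneg fun x => mul_nonneg (by positivity) (hφ x)
  have hB : 0 ≤ ∫ x, φ x ∂μ := integral_nonneg hφ
  refine (Real.rpow_le_rpow (abs_nonneg _) (abs_integral_le_integral_abs.trans holder)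
    hp0.le).trans_eq ?_
  rw [Real.mul_rpow (by positivity) (by positivity), ← Real.rpow_mul hA, ← Real.rpow_mul hB,
    one_div_mul_cancel hp0.ne', Real.rpow_one, one_div_mul_eq_div, hpq.div_conj_eq_sub_one]

section Ball

variable {n : ℕ} {p ρ : ℝ} {u : Space n → ℝ}

lemma integrableOn_abs_rpow (hp : 1 < p)
    (hu : MemLp u (ENNReal.ofReal p) (volume.restrict (closedBall 0 ρ))) :
    IntegrableOn (fun x => |u x| ^ p) (closedBall 0 ρ) := by
  have hp0 : 0 < p := one_pos.trans hp
  simpa [IntegrableOn, ENNReal.toReal_ofReal hp0.le] using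
    hu.integrable_norm_rpow (by simpa) ENNReal.ofReal_ne_top

lemma le_setIntegral_abs_rpow_mul_exp (hn : 1 ≤ n) (hp : 1 < p) (hρ : 0 < ρ)
    (hu : MemLp u (ENNReal.ofReal p) (volume.restrict (closedBall 0 ρ))) {ξ : Space n}
    (hξ : 1 ≤ ‖ξ‖) {K : ℝ} (hK : 0 ≤ K)
    (hKu : K ≤ ∫ x in closedBall 0 ρ, u x * Real.exp (inner ℝ x ξ - ‖ξ‖ * ρ)) :
    K ^ p * (2 * √(4 * Real.pi) ^ (n - 1) * ρ ^ (((n : ℝ) - 1) / 2)) ^ (-(p - 1))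
      ≤ ∫ x in closedBall 0 ρ, |u x| ^ p * Real.exp (inner ℝ x ξ - ‖ξ‖ * ρ) := by
  have hcont : Continuous fun x : Space n => Real.exp (inner ℝ x ξ - ‖ξ‖ * ρ) := by fun_prop
  have hcomp := isCompact_closedBall (0 : Space n) ρ
  have holder := abs_integral_mul_rpow_le hp (fun x => (Real.exp_pos _).le)
    hu.aestronglyMeasurable (hcont.continuousOn.integrableOn_compact hcomp)
    ((integrableOn_abs_rpow hp hu).mul_continuousOn hcont.continuousOn hcomp)
  have hJ : 0 ≤ ∫ x in closedBall 0 ρ, |u x| ^ p * Real.exp (inner ℝ x ξ - ‖ξ‖ * ρ) :=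
    integral_nonneg fun x => by positivity
  have hI : 0 ≤ ∫ x in closedBall (0 : Space n) ρ, Real.exp (inner ℝ x ξ - ‖ξ‖ * ρ) :=
    integral_nonneg fun x => by positivity
  rw [Real.rpow_neg (by positivity), ← div_eq_mul_inv, div_le_iff₀ (by positivity)]
  calc K ^ p ≤ |∫ x in closedBall 0 ρ, u x * Real.exp (inner ℝ x ξ - ‖ξ‖ * ρ)| ^ p :=
        Real.rpow_le_rpow hK (hKu.trans (le_abs_self _)) (by linarith)
    _ ≤ _ := holder
    _ ≤ _ := mul_le_mul_of_nonneg_left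
        (Real.rpow_le_rpow hI (setIntegral_exp_inner_sub_le hn hρ hξ) (by linarith)) hJ

/-- Tonelli: averaging over the frequencies gains the factor `ρ^(-(n-1)/2)`. -/
lemma mul_measureReal_le_of_le_setIntegral_mul_exp (hn : 1 ≤ n) (hρ : 0 < ρ)
    {D : Set (Space n)} (hDm : MeasurableSet D) (hD : ∀ ξ ∈ D, ‖ξ‖ ≤ 2) {v : Space n → ℝ}
    (hv : 0 ≤ v) (hvm : Measurable v) (hvi : IntegrableOn v (closedBall 0 ρ)) {L : ℝ} (hL : 0 ≤ L)
    (hLv : ∀ ξ ∈ D, L ≤ ∫ x in closedBall 0 ρ, v x * Real.exp (inner ℝ x ξ - ‖ξ‖ * ρ)) :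
    L * volume.real D
      ≤ 4 * √(4 * Real.pi) ^ (n - 1) * ρ ^ (-(((n : ℝ) - 1) / 2)) * ∫ x in closedBall 0 ρ, v x := by
  set C := 4 * √(4 * Real.pi) ^ (n - 1) * ρ ^ (-(((n : ℝ) - 1) / 2))
  have hC : 0 ≤ C := by positivity
  have hDtop : volume D ≠ ⊤ := ((measure_mono fun ξ hξ => mem_closedBall_zero_iff.2
    (hD ξ hξ)).trans_lt (measure_closedBall_lt_top (x := (0 : Space n)) (r := 2))).ne
  have hint : 0 ≤ ∫ x in closedBall 0 ρ, v x := integral_nonneg hv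
  have hmeas : Measurable (Function.uncurry fun ξ x : Space n =>
      ENNReal.ofReal (v x) * ENNReal.ofReal (Real.exp (inner ℝ x ξ - ‖ξ‖ * ρ))) := by
    have hexp : Continuous fun z : Space n × Space n => Real.exp (inner ℝ z.2 z.1 - ‖z.1‖ * ρ) := by
      fun_prop
    exact (hvm.comp measurable_snd).ennreal_ofReal.mul hexp.measurable.ennreal_ofReal
  have hlint : ∀ ξ, ENNReal.ofReal (∫ x in closedBall 0 ρ, v x * Real.exp (inner ℝ x ξ - ‖ξ‖ * ρ))
      = ∫⁻ x in closedBall 0 ρ,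
        ENNReal.ofReal (v x) * ENNReal.ofReal (Real.exp (inner ℝ x ξ - ‖ξ‖ * ρ)) := fun ξ => by
    have hvexp : IntegrableOn (fun x => v x * Real.exp (inner ℝ x ξ - ‖ξ‖ * ρ)) (closedBall 0 ρ) :=
      hvi.mul_continuousOn (by fun_prop) (isCompact_closedBall _ _)
    rw [ofReal_integral_eq_lintegral_ofReal hvexp
      (.of_forall fun x => mul_nonneg (hv x) (Real.exp_pos _).le)]
    exact lintegral_congr fun x => ENNReal.ofReal_mul (hv x)
  rw [← ENNReal.ofReal_le_ofReal_iff (by positivity)]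
  calc ENNReal.ofReal (L * volume.real D) = ∫⁻ _ in D, ENNReal.ofReal L := by
        rw [setLIntegral_const, ENNReal.ofReal_mul hL, ofReal_measureReal hDtop]
    _ ≤ ∫⁻ ξ in D, ∫⁻ x in closedBall 0 ρ,
          ENNReal.ofReal (v x) * ENNReal.ofReal (Real.exp (inner ℝ x ξ - ‖ξ‖ * ρ)) :=
        setLIntegral_mono' hDm fun ξ hξ => (ENNReal.ofReal_le_ofReal (hLv ξ hξ)).trans_eq (hlint ξ)
    _ = ∫⁻ x in closedBall 0 ρ, ∫⁻ ξ in D,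
          ENNReal.ofReal (v x) * ENNReal.ofReal (Real.exp (inner ℝ x ξ - ‖ξ‖ * ρ)) :=
        lintegral_lintegral_swap hmeas.aemeasurable
    _ ≤ ∫⁻ x in closedBall 0 ρ, ENNReal.ofReal (v x) * ENNReal.ofReal C := by
        refine setLIntegral_mono' isClosed_closedBall.measurableSet fun x hx => ?_
        rw [lintegral_const_mul' _ _ ENNReal.ofReal_ne_top]
        gcongr
        exact lintegral_exp_inner_sub_le hn hρ (mem_closedBall_zero_iff.1 hx) hDm hD
    _ = ENNReal.ofReal (C * ∫ x in closedBall 0 ρ, v x) := by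
        rw [lintegral_mul_const' _ _ ENNReal.ofReal_ne_top, mul_comm, ENNReal.ofReal_mul hC,
          ofReal_integral_eq_lintegral_ofReal hvi (.of_forall hv)]

lemma measureReal_norm_preimage_Icc_pos (hn : 1 ≤ n) :
    0 < volume.real (norm ⁻¹' Icc 1 2 : Set (Space n)) := by
  have hsub : (norm ⁻¹' Icc 1 2 : Set (Space n)) ⊆ closedBall 0 2 := fun ξ hξ =>
    mem_closedBall_zero_iff.2 hξ.2
  refine ENNReal.toReal_pos (measure_pos_of_superset (preimage_mono Ioo_subset_Icc_self)
    ((isOpen_Ioo.preimage continuous_norm).measure_ne_zero _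
      ⟨EuclideanSpace.single ⟨0, hn⟩ (3 / 2), ?_⟩)).ne'
    ((measure_mono hsub).trans_lt measure_closedBall_lt_top).ne
  rw [mem_preimage, PiLp.norm_single]
  norm_num

lemma exists_le_setIntegral_abs_rpow_of_exp (hn : 1 ≤ n) (hp : 1 < p) :
    ∃ c : ℝ, 0 < c ∧ ∀ (ρ : ℝ) (u : Space n → ℝ) (K : ℝ), 0 < ρ → Measurable u →
      MemLp u (ENNReal.ofReal p) (volume.restrict (closedBall 0 ρ)) → 0 ≤ K →
      (∀ ξ : Space n, ‖ξ‖ ∈ Icc 1 2 →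
        K ≤ ∫ x in closedBall 0 ρ, u x * Real.exp (inner ℝ x ξ - ‖ξ‖ * ρ)) →
      c * K ^ p * ρ ^ (((n : ℝ) - 1) / 2 * (2 - p)) ≤ ∫ x in closedBall 0 ρ, |u x| ^ p := by
  set m := ((n : ℝ) - 1) / 2
  obtain ⟨C₁, hC₁, hC₁eq⟩ : ∃ C, 0 < C ∧ 2 * √(4 * Real.pi) ^ (n - 1) = C :=
    ⟨_, by positivity, rfl⟩
  obtain ⟨C₂, hC₂, hC₂eq⟩ : ∃ C, 0 < C ∧ 4 * √(4 * Real.pi) ^ (n - 1) = C :=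
    ⟨_, by positivity, rfl⟩
  obtain ⟨d, hd, hdeq⟩ : ∃ d, 0 < d ∧ volume.real (norm ⁻¹' Icc 1 2 : Set (Space n)) = d :=
    ⟨_, measureReal_norm_preimage_Icc_pos hn, rfl⟩
  refine ⟨d / C₂ * C₁ ^ (-(p - 1)), by positivity, fun ρ u K hρ hum hu hK hKu => ?_⟩
  have h := mul_measureReal_le_of_le_setIntegral_mul_exp hn hρ
    (measurableSet_Icc.preimage measurable_norm) (fun ξ hξ => hξ.2)
    (fun x => Real.rpow_nonneg (abs_nonneg (u x)) p) (hum.abs.pow_const p)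
    (integrableOn_abs_rpow hp hu) (by positivity)
    fun ξ hξ => le_setIntegral_abs_rpow_mul_exp hn hp hρ hu hξ.1 hK (hKu ξ hξ)
  rw [hC₁eq, hC₂eq, hdeq, Real.mul_rpow hC₁.le (by positivity), Real.rpow_neg hρ.le m] at h
  have hexp : ρ ^ (m * (2 - p)) = (ρ ^ m) ^ (-(p - 1)) * ρ ^ m := by
    rw [← Real.rpow_mul hρ.le, ← Real.rpow_add hρ]
    ring_nf
  calc d / C₂ * C₁ ^ (-(p - 1)) * K ^ p * ρ ^ (m * (2 - p))
      = ρ ^ m / C₂ * (K ^ p * (C₁ ^ (-(p - 1)) * (ρ ^ m) ^ (-(p - 1))) * d) := by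
        rw [hexp]
        ring
    _ ≤ ρ ^ m / C₂ * (C₂ * (ρ ^ m)⁻¹ * ∫ x in closedBall 0 ρ, |u x| ^ p) := by gcongr
    _ = ∫ x in closedBall 0 ρ, |u x| ^ p := by field_simp

lemma exists_le_setIntegral_abs_rpow_of_integral (n : ℕ) {p : ℝ} (hp : 1 < p) :
    ∃ c : ℝ, 0 < c ∧ ∀ (ρ : ℝ) (u : Space n → ℝ), 0 < ρ →
      MemLp u (ENNReal.ofReal p) (volume.restrict (closedBall 0 ρ)) →
      c * ρ ^ (-((n : ℝ) * (p - 1))) * |∫ x in closedBall 0 ρ, u x| ^ p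
        ≤ ∫ x in closedBall 0 ρ, |u x| ^ p := by
  obtain ⟨v, hv, hveq⟩ : ∃ v, 0 < v ∧ volume.real (ball (0 : Space n) 1) = v :=
    ⟨_, ENNReal.toReal_pos (measure_ball_pos _ _ one_pos).ne' measure_ball_lt_top.ne, rfl⟩
  refine ⟨v ^ (-(p - 1)), by positivity, fun ρ u hρ hu => ?_⟩
  have hvol : volume.real (closedBall (0 : Space n) ρ) = ρ ^ (n : ℝ) * v := by
    rw [measureReal_def, Measure.addHaar_closedBall _ _ hρ.le, ENNReal.toReal_mul,
      ENNReal.toReal_ofReal (by positivity), ← measureReal_def, hveq]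
    simp
  have : IsFiniteMeasure (volume.restrict (closedBall (0 : Space n) ρ)) :=
    ⟨by simpa using measure_closedBall_lt_top⟩
  have holder := abs_integral_mul_rpow_le hp zero_le_one hu.aestronglyMeasurable
    (integrable_const 1) (by simpa [IntegrableOn] using integrableOn_abs_rpow hp hu)
  simp only [Pi.one_apply, mul_one, integral_const, smul_eq_mul, measureReal_restrict_apply_univ,
    hvol] at holder
  rw [Real.mul_rpow (by positivity) hv.le, ← Real.rpow_mul hρ.le] at holder
  rw [Real.rpow_neg hv.le, Real.rpow_neg hρ.le, ← mul_inv, inv_mul_le_iff₀ (by positivity)]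
  linarith

end Ball

/-! ### Initial data -/

section InitialData

variable {n : ℕ}

lemma eq_zero_of_fn_eq_zero {f : H1 n} (hf : fn f = 0) : f = 0 := by
  have hf' : ∀ᵐ x, fn f x = 0 := (Lp.eq_zero_iff_ae_eq_zero).1 hf
  have hcomponent : ∀ e : Space n, ∀ᵐ x, inner ℝ (grad f x) e = 0 := by
    intro e
    refine ae_eq_zero_of_integral_contDiff_smul_eq_zero
      (((Lp.memLp (grad f)).inner_const e).locallyIntegrable (by norm_num)) fun φ hφ hc => ?_
    have hleft : ∫ x, fn f x * fderiv ℝ φ x e = 0 := by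
      refine integral_eq_zero_of_ae ?_
      filter_upwards [hf'] with x hx
      rw [hx, zero_mul, Pi.zero_apply]
    simp_rw [smul_eq_mul, mul_comm (φ _)]
    exact neg_eq_zero.1 ((f.2 φ hφ hc e).symm.trans hleft)
  have hgrad : grad f = 0 := by
    rw [Lp.eq_zero_iff_ae_eq_zero]
    filter_upwards [ae_all_iff.2 fun i => hcomponent (EuclideanSpace.basisFun (Fin n) ℝ i)]
      with x hx
    ext i
    simpa [EuclideanSpace.inner_single_right] using hx i
  exact Subtype.ext (Prod.ext hf hgrad)

lemma integrableOn_closedBall (u : L2 n) (r : ℝ) : IntegrableOn u (closedBall 0 r) :=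
  ((Lp.memLp u).locallyIntegrable (by norm_num)).integrableOn_isCompact (isCompact_closedBall _ _)

lemma exists_setIntegral_closedBall_pos {u : L2 n} (hu : 0 ≤ u) (hne : u ≠ 0) :
    ∃ r : ℝ, 0 < ∫ x in closedBall 0 r, u x := by
  by_contra! hle
  have hu' : 0 ≤ᵐ[volume] u := (Lp.coeFn_nonneg u).2 hu
  have hball : ∀ k : ℕ, ∀ᵐ x, x ∈ closedBall (0 : Space n) k → u x = 0 := fun k =>
    (ae_restrict_iff' measurableSet_closedBall).1 <|
      (setIntegral_eq_zero_iff_of_nonneg_ae (ae_restrict_of_ae hu')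
        (integrableOn_closedBall u k)).1 ((hle k).antisymm (setIntegral_nonneg_of_ae hu'))
  refine hne (Lp.eq_zero_iff_ae_eq_zero.2 ?_)
  filter_upwards [ae_all_iff.2 hball] with x hx
  obtain ⟨k, hk⟩ := exists_nat_ge ‖x‖
  exact hx k (mem_closedBall_zero_iff.2 hk)

lemma exp_mul_setIntegral_le_moment {u : L2 n} (hu : 0 ≤ u) {η : ContDiffBump (0 : Space n)}
    {ξ : Space n} {r κ : ℝ} (hr : r ≤ η.rIn) (hξ : ‖ξ‖ ≤ κ) :
    Real.exp (-(r * κ)) * ∫ x in closedBall 0 r, u x ≤ moment η ξ u := by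
  have hu' : 0 ≤ᵐ[volume] u := (Lp.coeFn_nonneg u).2 hu
  have hint := integrable_mul_expTest η ξ u
  rw [moment_apply, ← integral_const_mul]
  calc ∫ x in closedBall 0 r, Real.exp (-(r * κ)) * u x
      ≤ ∫ x in closedBall 0 r, u x * expTest η ξ x := by
        refine setIntegral_mono_on_ae ((integrableOn_closedBall u r).const_mul _)
          hint.integrableOn measurableSet_closedBall ?_
        filter_upwards [hu'] with x hx hxr
        rw [mem_closedBall_zero_iff] at hxr
        rw [mul_comm, expTest_eq (hxr.trans hr)]
        refine mul_le_mul_of_nonneg_left (Real.exp_le_exp.2 ?_) hx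
        refine (neg_le_neg ?_).trans (neg_le_of_abs_le (abs_real_inner_le_norm x ξ))
        exact mul_le_mul hxr hξ (norm_nonneg _) ((norm_nonneg _).trans hxr)
    _ ≤ ∫ x, u x * expTest η ξ x := by
        refine setIntegral_le_integral hint ?_
        filter_upwards [hu'] with x hx
        exact mul_nonneg hx (expTest_nonneg η ξ x)

lemma exists_le_moment {u : L2 n} (hu : 0 ≤ u) (hne : u ≠ 0) (κ : ℝ) :
    ∃ A r : ℝ, 0 < A ∧ ∀ η : ContDiffBump (0 : Space n), r ≤ η.rIn →
      ∀ ξ : Space n, ‖ξ‖ ≤ κ → A ≤ moment η ξ u := by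
  obtain ⟨r, hr⟩ := exists_setIntegral_closedBall_pos hu hne
  exact ⟨_, r, mul_pos (Real.exp_pos _) hr, fun η hη ξ hξ => exp_mul_setIntegral_le_moment hu hη hξ⟩

end InitialData

/-! ### Lower bounds for the mass -/

/-- What the lower bounds use of an energy solution `u` on `[0, t₁]` with time derivative `v`: it
lives in the cone `‖x‖ ≤ t + R`, where the cut-off `η` equals one, its moments solve the damped
equation with multiplier `m` and mass coefficient `-b`, and `A` bounds the initial moments from
below. -/
structure HasMoments {n : ℕ} (m : ℝ → ℝ) (b p R A t₁ : ℝ) (η : ContDiffBump (0 : Space n))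
    (u v : ℝ → L2 n) : Prop where
  add_le_rIn : t₁ + R ≤ η.rIn
  memLp : ∀ t ∈ Ioc 0 t₁,
    MemLp (u t) (ENNReal.ofReal p) (volume.restrict (closedBall 0 (t + R)))
  eq_zero : ∀ t ∈ Ioc 0 t₁, ∀ᵐ x : Space n, t + R < ‖x‖ → u t x = 0
  isMoment : ∀ ξ : Space n, IsMoment m (fun t => ‖ξ‖ ^ 2 + b / (1 + t) ^ 2) t₁
    (fun t => moment η ξ (u t)) (fun t => moment η ξ (v t))
    (fun t => ∫ x, |u t x| ^ p * expTest η ξ x)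
  le_init : ∀ ξ : Space n, ‖ξ‖ ≤ 2 → A ≤ moment η ξ (v 0) + moment η ξ (u 0)

lemma integral_mul_expTest_eq {n : ℕ} {η : ContDiffBump (0 : Space n)} (ξ : Space n) {r : ℝ}
    (hr : r ≤ η.rIn) {v : Space n → ℝ} (hv : ∀ᵐ x, r < ‖x‖ → v x = 0) :
    ∫ x, v x * expTest η ξ x = ∫ x in closedBall 0 r, v x * Real.exp (inner ℝ x ξ) := by
  rw [← setIntegral_eq_integral_of_ae_compl_eq_zero (s := closedBall (0 : Space n) r)]
  · refine setIntegral_congr_fun measurableSet_closedBall fun x hx => ?_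
    rw [mem_closedBall_zero_iff] at hx
    simp only [expTest_eq (hx.trans hr)]
  · filter_upwards [hv] with x hx hxr
    rw [mem_closedBall_zero_iff, not_le] at hxr
    rw [hx hxr, zero_mul]

lemma min_rpow_mul_le {x y a b e : ℝ} (hy : 0 < y) (ha : 0 < a) (hax : a * y ≤ x)
    (hxb : x ≤ b * y) : min (a ^ e) (b ^ e) * y ^ e ≤ x ^ e := by
  have hx : 0 < x := (mul_pos ha hy).trans_le hax
  have hb : 0 < b := pos_of_mul_pos_left (hx.trans_le hxb) hy.le
  rcases le_or_gt 0 e with he | he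
  · calc min (a ^ e) (b ^ e) * y ^ e ≤ a ^ e * y ^ e := by gcongr; exact min_le_left _ _
      _ = (a * y) ^ e := (Real.mul_rpow ha.le hy.le).symm
      _ ≤ x ^ e := Real.rpow_le_rpow (mul_pos ha hy).le hax he
  · calc min (a ^ e) (b ^ e) * y ^ e ≤ b ^ e * y ^ e := by gcongr; exact min_le_right _ _
      _ = (b * y) ^ e := (Real.mul_rpow hb.le hy.le).symm
      _ ≤ x ^ e := Real.rpow_le_rpow_of_nonpos hx hxb he.le

section HasMoments

variable {n : ℕ} {m : ℝ → ℝ} {b p R A t₁ t : ℝ} {η : ContDiffBump (0 : Space n)} {u v : ℝ → L2 n}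

namespace HasMoments

lemma moment_eq (h : HasMoments m b p R A t₁ η u v) (ξ : Space n) (ht : t ∈ Ioc 0 t₁) :
    moment η ξ (u t) = ∫ x in closedBall 0 (t + R), u t x * Real.exp (inner ℝ x ξ) := by
  rw [moment_apply,
    integral_mul_expTest_eq ξ (by linarith [ht.2, h.add_le_rIn]) (h.eq_zero t ht)]

lemma source_eq (h : HasMoments m b p R A t₁ η u v) (hp : p ≠ 0) (ht : t ∈ Ioc 0 t₁) :
    ∫ x, |u t x| ^ p * expTest η 0 x = ∫ x in closedBall 0 (t + R), |u t x| ^ p := by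
  rw [integral_mul_expTest_eq 0 (r := t + R) (by linarith [ht.2, h.add_le_rIn])]
  · simp only [inner_zero_right, Real.exp_zero, mul_one]
  · filter_upwards [h.eq_zero t ht] with x hx hxr
    rw [hx hxr, abs_zero, Real.zero_rpow hp]

lemma mul_exp_le_moment (h : HasMoments m b p R A t₁ η u v) (hb : 0 ≤ b) {ξ : Space n}
    (hξ : ‖ξ‖ ∈ Icc 1 2) (ht : t ∈ Icc 1 t₁) :
    m 0 * A / 8 * Real.exp (‖ξ‖ * t) ≤ moment η ξ (u t) := by
  have hm := h.isMoment ξ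
  have hgrowth := hm.mul_exp_le hξ.1
    (fun s _ => le_add_of_nonneg_right (div_nonneg hb (sq_nonneg _))) ht
  refine le_trans ?_ hgrowth
  have hinit : A ≤ moment η ξ (v 0) + ‖ξ‖ * moment η ξ (u 0) :=
    (h.le_init ξ hξ.2).trans (by gcongr; exact le_mul_of_one_le_left hm.zero_nonneg hξ.1)
  have hinit0 : 0 ≤ moment η ξ (v 0) + ‖ξ‖ * moment η ξ (u 0) :=
    add_nonneg hm.deriv_zero_nonneg (mul_nonneg (norm_nonneg _) hm.zero_nonneg)
  have hm0 := hm.multiplier.pos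
  have hξ0 : 0 < ‖ξ‖ := by linarith [hξ.1]
  gcongr
  linarith [hξ.2]

lemma mul_rpow_le_moment (h : HasMoments m b p R A t₁ η u v) {k : ℝ} (hk : 1 ≤ k)
    (hkb : k * (k - 1) = m 0 * b) (ht : t ∈ Icc 1 t₁) :
    min (m 0) (k - 1) / (2 * (2 * k - 1)) * A * t ^ k ≤ moment η 0 (u t) := by
  have hm := h.isMoment 0
  have hpotential : ∀ s ∈ Icc 0 t₁,
      k * (k - 1) ≤ m 0 * (‖(0 : Space n)‖ ^ 2 + b / (1 + s) ^ 2) * (1 + s) ^ 2 := by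
    intro s hs
    have : (1 + s) ^ 2 ≠ 0 := (pow_pos (by linarith [hs.1]) 2).ne'
    rw [hkb, norm_zero, zero_pow two_ne_zero, zero_add, mul_assoc, div_mul_cancel₀ _ this]
  have hinit : min (m 0) (k - 1) * A ≤ m 0 * moment η 0 (v 0) + (k - 1) * moment η 0 (u 0) := by
    have hmin : 0 ≤ min (m 0) (k - 1) := le_min hm.multiplier.pos.le (by linarith)
    calc min (m 0) (k - 1) * A
        ≤ min (m 0) (k - 1) * (moment η 0 (v 0) + moment η 0 (u 0)) :=
          mul_le_mul_of_nonneg_left (h.le_init 0 (by simp)) hmin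
      _ ≤ m 0 * moment η 0 (v 0) + (k - 1) * moment η 0 (u 0) := by
          rw [mul_add]
          exact add_le_add (mul_le_mul_of_nonneg_right (min_le_left _ _) hm.deriv_zero_nonneg)
            (mul_le_mul_of_nonneg_right (min_le_right _ _) hm.zero_nonneg)
  have hinit0 : 0 ≤ m 0 * moment η 0 (v 0) + (k - 1) * moment η 0 (u 0) :=
    add_nonneg (mul_nonneg hm.multiplier.pos.le hm.deriv_zero_nonneg)
      (mul_nonneg (by linarith) hm.zero_nonneg)
  have hk2 : 0 < 2 * (2 * k - 1) := by linarith
  have ht0 : 0 ≤ t := by linarith [ht.1]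
  have htk : t ^ k ≤ (1 + t) ^ k := Real.rpow_le_rpow ht0 (by linarith) (by linarith)
  refine le_trans ?_ (hm.mul_rpow_le hk hpotential ht)
  rw [div_mul_eq_mul_div]
  exact mul_le_mul (div_le_div_of_nonneg_right hinit hk2.le) htk (Real.rpow_nonneg ht0 k)
    (div_nonneg hinit0 hk2.le)

end HasMoments

lemma exists_mass_rpow_le_source (n : ℕ) (hp : 1 < p) (hR : 1 ≤ R) :
    ∃ c : ℝ, 0 < c ∧ ∀ (m : ℝ → ℝ) (b A t₁ : ℝ) (η : ContDiffBump (0 : Space n)) (u v : ℝ → L2 n),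
      HasMoments m b p R A t₁ η u v → ∀ t ∈ Ioc 0 t₁,
      c * (1 + t) ^ (-((n : ℝ) * (p - 1))) * moment η 0 (u t) ^ p
        ≤ ∫ x, |u t x| ^ p * expTest η 0 x := by
  obtain ⟨c, hc, hle⟩ := exists_le_setIntegral_abs_rpow_of_integral n hp
  refine ⟨c * R ^ (-((n : ℝ) * (p - 1))), by positivity, fun m b A t₁ η u v h t ht => ?_⟩
  have ht0 : 0 < t := ht.1
  have hmass := hle (t + R) (u t) (by linarith) (h.memLp t ht)
  have hmoment : moment η 0 (u t) = ∫ x in closedBall 0 (t + R), u t x := by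
    simpa only [inner_zero_right, Real.exp_zero, mul_one] using h.moment_eq 0 ht
  rw [h.source_eq (by linarith) ht]
  refine le_trans ?_ hmass
  rw [← hmoment, abs_of_nonneg ((h.isMoment 0).nonneg (Ioc_subset_Icc_self ht)), mul_assoc c,
    ← Real.mul_rpow (by linarith) (by linarith)]
  have hpow := Real.rpow_nonneg ((h.isMoment 0).nonneg (Ioc_subset_Icc_self ht)) p
  refine mul_le_mul_of_nonneg_right (mul_le_mul_of_nonneg_left ?_ hc.le) hpow
  refine Real.rpow_le_rpow_of_nonpos (by linarith) (by nlinarith) (neg_nonpos.2 ?_)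
  exact mul_nonneg n.cast_nonneg (by linarith)

lemma exists_mul_sq_mul_mass_rpow_le (n : ℕ) (hp : 1 < p) (hR : 1 ≤ R) (hm : 0 < m 0) :
    ∃ c : ℝ, 0 < c ∧ ∀ (b A t₁ : ℝ) (η : ContDiffBump (0 : Space n)) (u v : ℝ → L2 n),
      HasMoments m b p R A t₁ η u v → ∀ t r, 1 ≤ t → 0 ≤ r → t + r ≤ t₁ →
      c * (1 + (t + r)) ^ (-((n : ℝ) * (p - 1))) * r ^ 2 * moment η 0 (u t) ^ p
        ≤ moment η 0 (u (t + r)) := by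
  obtain ⟨c, hc, hsource⟩ := exists_mass_rpow_le_source n hp hR
  refine ⟨m 0 * c / 4, by positivity, fun b A t₁ η u v h t r ht hr htr => ?_⟩
  have hmom := h.isMoment 0
  have ht' : t ∈ Icc 0 t₁ := ⟨by linarith, by linarith⟩
  have hG : 0 ≤ moment η 0 (u t) := hmom.nonneg ht'
  have hstep := hmom.add_le_of_le_source (by linarith) hr htr
    (l := c * (1 + (t + r)) ^ (-((n : ℝ) * (p - 1))) * moment η 0 (u t) ^ p)
    (by positivity) fun s hs => ?_
  · linarith
  · have hs' : s ∈ Icc 0 t₁ := ⟨by linarith [hs.1], by linarith [hs.2]⟩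
    refine le_trans ?_ (hsource m b A t₁ η u v h s ⟨by linarith [hs.1], hs'.2⟩)
    have hdecay : (1 + (t + r)) ^ (-((n : ℝ) * (p - 1))) ≤ (1 + s) ^ (-((n : ℝ) * (p - 1))) :=
      Real.rpow_le_rpow_of_nonpos (by linarith [hs.1]) (by linarith [hs.2])
        (neg_nonpos.2 (mul_nonneg n.cast_nonneg (by linarith)))
    have hmono : moment η 0 (u t) ≤ moment η 0 (u s) := hmom.monotoneOn ht' hs' hs.1.le
    have hs1 : 0 ≤ 1 + s := by linarith [hs'.1]
    gcongr

lemma exists_rpow_le_source (hn : 1 ≤ n) (hp : 1 < p) (hR : 0 ≤ R) (hm : 0 < m 0) (hb : 0 ≤ b) :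
    ∃ c : ℝ, 0 < c ∧ ∀ (A t₁ : ℝ) (η : ContDiffBump (0 : Space n)) (u v : ℝ → L2 n), 0 ≤ A →
      HasMoments m b p R A t₁ η u v → ∀ t ∈ Icc 1 t₁,
      c * A ^ p * t ^ (((n : ℝ) - 1) / 2 * (2 - p)) ≤ ∫ x, |u t x| ^ p * expTest η 0 x := by
  obtain ⟨c, hc, hle⟩ := exists_le_setIntegral_abs_rpow_of_exp hn hp
  set e := ((n : ℝ) - 1) / 2 * (2 - p)
  obtain ⟨a, ha, ha_eq⟩ : ∃ a, 0 < a ∧ m 0 / 8 * Real.exp (-(2 * R)) = a :=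
    ⟨_, by positivity, rfl⟩
  refine ⟨c * a ^ p * min (1 ^ e) ((1 + R) ^ e), by positivity,
    fun A t₁ η u v hA h t ht => ?_⟩
  have ht0 : 0 < t := by linarith [ht.1]
  have ht' : t ∈ Ioc 0 t₁ := ⟨ht0, ht.2⟩
  rw [h.source_eq (by linarith) ht']
  refine le_trans ?_ (hle (t + R) (u t) (a * A) (by linarith)
    (Lp.stronglyMeasurable (u t)).measurable (h.memLp t ht') (by positivity) fun ξ hξ => ?_)
  · have hshift : min (1 ^ e) ((1 + R) ^ e) * t ^ e ≤ (t + R) ^ e :=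
      min_rpow_mul_le ht0 one_pos (by linarith) (by nlinarith [ht.1])
    calc c * a ^ p * min (1 ^ e) ((1 + R) ^ e) * A ^ p * t ^ e
        = c * (a * A) ^ p * (min (1 ^ e) ((1 + R) ^ e) * t ^ e) := by
          rw [Real.mul_rpow ha.le hA]
          ring
      _ ≤ c * (a * A) ^ p * (t + R) ^ e := by gcongr
  · have hR2 : ‖ξ‖ * R ≤ 2 * R := mul_le_mul_of_nonneg_right hξ.2 hR
    simp_rw [sub_eq_add_neg, Real.exp_add, ← mul_assoc]
    rw [integral_mul_const, ← h.moment_eq ξ ht']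
    calc a * A = m 0 * A / 8 * Real.exp (-(2 * R)) := by
          rw [← ha_eq]
          ring
      _ ≤ m 0 * A / 8 * Real.exp (‖ξ‖ * t + -(‖ξ‖ * (t + R))) := by
          gcongr
          linarith
      _ ≤ moment η ξ (u t) * Real.exp (-(‖ξ‖ * (t + R))) := by
          rw [Real.exp_add, ← mul_assoc]
          gcongr
          exact h.mul_exp_le_moment hb hξ ht

lemma exists_rpow_le_mass (hn : 1 ≤ n) (hp : 1 < p) (hR : 0 ≤ R) (hm : 0 < m 0) (hb : 0 ≤ b) :
    ∃ c : ℝ, 0 < c ∧ ∀ (A t₁ : ℝ) (η : ContDiffBump (0 : Space n)) (u v : ℝ → L2 n), 0 ≤ A →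
      HasMoments m b p R A t₁ η u v → ∀ t ∈ Icc 2 t₁,
      c * A ^ p * t ^ (((n : ℝ) - 1) / 2 * (2 - p) + 2) ≤ moment η 0 (u t) := by
  obtain ⟨c, hc, hsource⟩ := exists_rpow_le_source (b := b) hn hp hR hm hb
  set e := ((n : ℝ) - 1) / 2 * (2 - p)
  obtain ⟨k, hk, hk_eq⟩ : ∃ k, 0 < k ∧ min ((1 / 2 : ℝ) ^ e) (1 ^ e) = k :=
    ⟨_, by positivity, rfl⟩
  refine ⟨m 0 * (c * k) / 16, by positivity, fun A t₁ η u v hA h t ht => ?_⟩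
  have ht0 : 0 < t := by linarith [ht.1]
  have hhalf : t / 2 ∈ Icc 0 t₁ := ⟨by linarith, by linarith [ht.2]⟩
  have hstep := (h.isMoment 0).add_le_of_le_source (t := t / 2) (r := t / 2)
    (l := c * A ^ p * (k * t ^ e)) (by linarith) (by linarith) (by linarith [ht.2])
    (by positivity) fun s hs => ?_
  · have hnonneg := (h.isMoment 0).nonneg hhalf
    rw [add_halves] at hstep
    rw [Real.rpow_add ht0, Real.rpow_two]
    linarith
  · rw [add_halves] at hs
    refine le_trans ?_ (hsource A t₁ η u v hA h s
      ⟨by linarith [hs.1, ht.1], by linarith [hs.2, ht.2]⟩)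
    have hcompare := min_rpow_mul_le (x := s) (y := t) (a := 1 / 2) (b := 1) (e := e) ht0
      (by norm_num) (by linarith [hs.1]) (by linarith [hs.2])
    rw [hk_eq] at hcompare
    gcongr

end HasMoments

/-! ### Lifespan estimates -/

section Lifespan

variable {n : ℕ} {ν₁ ν₂ β p R : ℝ} {f : H1 n} {g : L2 n}

lemma exists_time_le {m : ℝ → ℝ} (hp : 1 < p) (hR : 1 ≤ R) (hm : 0 < m 0) {b c θ a : ℝ}
    (hc : 0 < c) (hΓ : 0 < 2 - n * (p - 1) + a * (p - 1))
    (hgrow : ∀ (A t₁ : ℝ) (η : ContDiffBump (0 : Space n)) (u v : ℝ → L2 n), 0 ≤ A →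
      HasMoments m b p R A t₁ η u v → ∀ t ∈ Icc 2 t₁, c * A ^ θ * t ^ a ≤ moment η 0 (u t)) :
    ∃ K : ℝ, 0 < K ∧ ∀ (A t₁ : ℝ) (η : ContDiffBump (0 : Space n)) (u v : ℝ → L2 n), 0 < A →
      HasMoments m b p R A t₁ η u v →
      t₁ ≤ 4 + K * A ^ (-(θ * (p - 1) / (2 - n * (p - 1) + a * (p - 1)))) := by
  obtain ⟨c₂, hc₂, hstep⟩ := exists_mul_sq_mul_mass_rpow_le n hp hR hm
  have hb : 0 ≤ n * (p - 1) := mul_nonneg n.cast_nonneg (by linarith)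
  set Γ := 2 - n * (p - 1) + a * (p - 1)
  set M := (4 * (4 : ℝ) ^ (1 / (p - 1)) / (c₂ * 4 ^ (-(n * (p - 1))))) ^ (1 / Γ)
  refine ⟨2 * (M * c ^ (-((p - 1) / Γ))), by positivity, fun A t₁ η u v hA h => ?_⟩
  rcases le_or_gt t₁ 4 with ht₁ | ht₁
  · exact ht₁.trans (le_add_of_nonneg_right (by positivity))
  · calc t₁ ≤ 2 * (M * (c * A ^ θ) ^ (-((p - 1) / Γ))) :=
          time_le_of_superlinear hc₂ hb hp (by positivity) hΓ ht₁ (h.isMoment 0).monotoneOn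
            (hstep b A t₁ η u v h) (hgrow A t₁ η u v hA.le h)
      _ = 2 * (M * c ^ (-((p - 1) / Γ))) * A ^ (-(θ * (p - 1) / Γ)) := by
          rw [Real.mul_rpow hc.le (by positivity), ← Real.rpow_mul hA.le, mul_neg, ← mul_div_assoc]
          ring
      _ ≤ 4 + 2 * (M * c ^ (-((p - 1) / Γ))) * A ^ (-(θ * (p - 1) / Γ)) := by linarith

lemma lifespan_le_of_hasMoments (hν₁ : 0 ≤ ν₁) (hν₂ : ν₂ ≤ 0) (hβ : 1 < β) (hf : 0 ≤ fn f)
    (hg : 0 ≤ g) {ε A r B : ℝ} (hε : 0 ≤ ε) (hB : 0 ≤ B)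
    (hA : ∀ η : ContDiffBump (0 : Space n), r ≤ η.rIn →
      ∀ ξ : Space n, ‖ξ‖ ≤ 2 → A ≤ moment η ξ (g + fn f))
    (h : ∀ (t₁ : ℝ) (η : ContDiffBump (0 : Space n)) (u v : ℝ → L2 n),
      HasMoments (damp ν₁ β) (-ν₂) p R (ε * A) t₁ η u v → t₁ ≤ B) :
    lifespan ν₁ ν₂ β p R ε f g ≤ ENNReal.ofReal B := by
  refine sSup_le ?_
  rintro T ⟨w, hw, hs⟩
  by_contra! hlt
  obtain ⟨t₁, -, hBt₁, hT⟩ := ENNReal.lt_iff_exists_real_btwn.1 hlt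
  rw [ENNReal.ofReal_lt_ofReal_iff_of_nonneg hB] at hBt₁
  have ht₁ : 0 < t₁ := hB.trans_lt hBt₁
  have hpos : 0 < max 0 (max r (t₁ + R)) + 1 := by positivity
  let η : ContDiffBump (0 : Space n) := ⟨_, _, hpos, lt_add_one _⟩
  have hη : max r (t₁ + R) < η.rIn := (le_max_right 0 _).trans_lt (lt_add_one _)
  have hηR : t₁ + R < η.rIn := (le_max_right _ _).trans_lt hη
  have hT' : ∀ t ∈ Ioc 0 t₁, t ∈ timeInterval T := fun t ht =>
    Icc_subset_timeInterval hT (Ioc_subset_Icc_self ht)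
  refine hBt₁.not_ge (h t₁ η (fun t => fn (w t)) (timeDeriv T w) ⟨hηR.le, fun t ht =>
    hw.memLp_loc t (hT' t ht) ht.1 _ (isCompact_closedBall _ _), fun t ht => hs t (hT' t ht),
    fun ξ => isMoment_of_isEnergySolution hw hs hν₁ hν₂ hβ hε hf hg ht₁ hT hηR ξ,
    fun ξ hξ => ?_⟩)
  rw [moment_init hw, moment_init_deriv hw, ← mul_add, ← map_add]
  exact mul_le_mul_of_nonneg_left (hA η ((le_max_left _ _).trans hη.le) ξ hξ) hε

lemma exists_lifespan_le_of_time_le (hν₁ : 0 ≤ ν₁) (hν₂ : ν₂ ≤ 0) (hβ : 1 < β) (hf : 0 ≤ fn f)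
    (hg : 0 ≤ g) (hfg : f ≠ 0 ∨ g ≠ 0) {K q : ℝ} (hK : 0 < K) (hq : 0 ≤ q)
    (h : ∀ (A t₁ : ℝ) (η : ContDiffBump (0 : Space n)) (u v : ℝ → L2 n), 0 < A →
      HasMoments (damp ν₁ β) (-ν₂) p R A t₁ η u v → t₁ ≤ 4 + K * A ^ (-q)) :
    ∃ C : ℝ, 0 < C ∧ ∀ ε : ℝ, 0 < ε → ε ≤ 1 →
      lifespan ν₁ ν₂ β p R ε f g ≤ ENNReal.ofReal (C * ε ^ (-q)) := by
  have hne : g + fn f ≠ 0 := fun h0 => by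
    obtain ⟨hg0, hf0⟩ := (add_eq_zero_iff_of_nonneg hg hf).1 h0
    exact hfg.elim (fun hf' => hf' (eq_zero_of_fn_eq_zero hf0)) fun hg' => hg' hg0
  obtain ⟨A, r, hA, hmoment⟩ := exists_le_moment (add_nonneg hg hf) hne 2
  refine ⟨4 + K * A ^ (-q), by positivity, fun ε hε hε1 => ?_⟩
  refine lifespan_le_of_hasMoments hν₁ hν₂ hβ hf hg hε.le (by positivity) hmoment
    fun t₁ η u v hu => ?_
  have hε_one : 1 ≤ ε ^ (-q) :=
    Real.one_le_rpow_of_pos_of_le_one_of_nonpos hε hε1 (neg_nonpos.2 hq)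
  calc t₁ ≤ 4 + K * (ε * A) ^ (-q) := h (ε * A) t₁ η u v (by positivity) hu
    _ ≤ (4 + K * A ^ (-q)) * ε ^ (-q) := by
        rw [Real.mul_rpow hε.le hA.le]
        linarith

lemma exists_lifespan_le_wave (hn : 1 ≤ n) (hp : 1 < p) (hR : 1 ≤ R) (hν₁ : 0 ≤ ν₁)
    (hν₂ : ν₂ ≤ 0) (hβ : 1 < β) (hf : 0 ≤ fn f) (hg : 0 ≤ g) (hfg : f ≠ 0 ∨ g ≠ 0)
    (hγ : 0 < gammaS p n) :
    ∃ C : ℝ, 0 < C ∧ ∀ ε : ℝ, 0 < ε → ε ≤ 1 → lifespan ν₁ ν₂ β p R ε f g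
      ≤ ENNReal.ofReal (C * ε ^ (-(2 * p * (p - 1) / gammaS p n))) := by
  have hm := (isMultiplier_damp hν₁ hβ).pos
  obtain ⟨c, hc, hgrow⟩ := exists_rpow_le_mass (R := R) hn hp (by linarith) hm (neg_nonneg.2 hν₂)
  have hΓ : 2 - n * (p - 1) + (((n : ℝ) - 1) / 2 * (2 - p) + 2) * (p - 1) = gammaS p n / 2 := by
    rw [gammaS]
    ring
  obtain ⟨K, hK, htime⟩ := exists_time_le (θ := p) hp hR hm hc (by rw [hΓ]; linarith) hgrow
  have hq : p * (p - 1) / (gammaS p n / 2) = 2 * p * (p - 1) / gammaS p n := by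
    rw [div_div_eq_mul_div, mul_comm _ (2 : ℝ), mul_assoc]
  rw [hΓ, hq] at htime
  refine exists_lifespan_le_of_time_le hν₁ hν₂ hβ hf hg hfg hK (div_nonneg ?_ hγ.le) htime
  exact mul_nonneg (by linarith) (by linarith)

lemma exists_lifespan_le_heat (hp : 1 < p) (hR : 1 ≤ R) (hν₁ : 0 ≤ ν₁) (hν₂ : ν₂ < 0)
    (hβ : 1 < β) (hf : 0 ≤ fn f) (hg : 0 ≤ g) (hfg : f ≠ 0 ∨ g ≠ 0)
    (hγ : 0 < gammaF p (n - (1 + √(delta ν₁ ν₂ β)) / 2)) :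
    ∃ C : ℝ, 0 < C ∧ ∀ ε : ℝ, 0 < ε → ε ≤ 1 → lifespan ν₁ ν₂ β p R ε f g ≤ ENNReal.ofReal
      (C * ε ^ (-((p - 1) / gammaF p (n - (1 + √(delta ν₁ ν₂ β)) / 2)))) := by
  have hm := (isMultiplier_damp hν₁ hβ).pos
  have hδ : 1 < √(delta ν₁ ν₂ β) := Real.lt_sqrt_of_sq_lt (by simpa using one_lt_delta hν₂)
  have hsq : √(delta ν₁ ν₂ β) ^ 2 = 1 - 4 * ν₂ * damp ν₁ β 0 := by
    rw [Real.sq_sqrt (zero_le_one.trans (one_lt_delta hν₂).le), delta, damp_zero]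
  set k := (1 + √(delta ν₁ ν₂ β)) / 2 with hk
  have hk1 : 1 < k := by linarith
  have hkν : k * (k - 1) = damp ν₁ β 0 * -ν₂ := by
    rw [hk]
    linear_combination hsq / 4
  have hΓ : 2 - n * (p - 1) + k * (p - 1) = gammaF p (n - k) := by
    rw [gammaF]
    ring
  have hc : 0 < min (damp ν₁ β 0) (k - 1) / (2 * (2 * k - 1)) :=
    div_pos (lt_min hm (by linarith)) (by linarith)
  obtain ⟨K, hK, htime⟩ := exists_time_le (n := n) (b := -ν₂) (θ := 1) (a := k) hp hR hm hc
    (by rwa [hΓ]) fun A t₁ η u v _ h t ht => by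
      rw [Real.rpow_one]
      exact h.mul_rpow_le_moment hk1.le hkν ⟨by linarith [ht.1], ht.2⟩
  rw [hΓ, one_mul] at htime
  exact exists_lifespan_le_of_time_le hν₁ hν₂.le hβ hf hg hfg hK
    (div_nonneg (by linarith) hγ.le) htime

lemma two_div_sub_eq_gammaF_div (hp : p ≠ 1) (x y : ℝ) :
    2 / (p - 1) - x + y = gammaF p (x - y) / (p - 1) := by
  have hp' : p - 1 ≠ 0 := sub_ne_zero.2 hp
  rw [gammaF]
  field_simp
  ring

end Lifespan

end NegMass

theorem theorem1p5 (n : ℕ) (hn : 1 ≤ n) (ν₁ ν₂ β δ : ℝ) (hν₁ : 0 ≤ ν₁) (hν₂ : ν₂ < 0)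
    (hβ : 1 < β) (hδ : δ = NegMass.delta ν₁ ν₂ β) :
    1 < δ ∧
    (0 ≤ NegMass.dStar n ∧ NegMass.dStar n < 2) ∧
    ((2 ≤ n → √δ ≤ n - NegMass.dStar n → NegMass.pDelta δ n = NegMass.pS n) ∧
      (2 ≤ n → n - NegMass.dStar n < √δ → √δ < 2 * n - 1 →
        NegMass.pDelta δ n = NegMass.pF (n - (1 + √δ) / 2)) ∧
      (n = 1 ∨ (2 ≤ n ∧ 2 * n - 1 ≤ √δ) → NegMass.pDelta δ n = ⊤)) ∧
    ∀ (p : ℝ), 1 < p → (p : EReal) < NegMass.pDelta δ n →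
    ∀ (f : NegMass.H1 n) (g : NegMass.L2 n), 0 ≤ NegMass.fn f → 0 ≤ g → (f ≠ 0 ∨ g ≠ 0) →
    ∀ (R : ℝ), 1 ≤ R →
    ∃ ε₅ : ℝ, 0 < ε₅ ∧ ∃ C : ℝ, 0 < C ∧ ∀ ε : ℝ, 0 < ε → ε ≤ ε₅ →
      (√δ ≤ n - 2 →
        NegMass.lifespan ν₁ ν₂ β p R ε f g
          ≤ ENNReal.ofReal (C * ε ^ (-(2 * p * (p - 1) / NegMass.gammaS p n)))) ∧
      (n - 2 < √δ → √δ < n - NegMass.dStar n →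
        (p ≤ 2 / (n - √δ) →
          NegMass.lifespan ν₁ ν₂ β p R ε f g
            ≤ ENNReal.ofReal
                (C * ε ^ (-((p - 1) / NegMass.gammaF p (n - (1 + √δ) / 2))))) ∧
        (2 / (n - √δ) < p →
          NegMass.lifespan ν₁ ν₂ β p R ε f g
            ≤ ENNReal.ofReal (C * ε ^ (-(2 * p * (p - 1) / NegMass.gammaS p n))))) ∧
      (n - NegMass.dStar n ≤ √δ →
        NegMass.lifespan ν₁ ν₂ β p R ε f g
            ≤ ENNReal.ofReal
                (C * ε ^ (-((p - 1) / NegMass.gammaF p (n - (1 + √δ) / 2)))) ∧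
        ε ^ (-((p - 1) / NegMass.gammaF p (n - (1 + √δ) / 2)))
          = ε ^ (-(2 / (p - 1) - n + (1 + √δ) / 2)⁻¹)) := by
  have hn1 : (1 : ℝ) ≤ n := by exact_mod_cast hn
  have hd := NegMass.dStar_nonneg hn1
  have hd2 := NegMass.dStar_lt_two hn1
  refine ⟨hδ ▸ NegMass.one_lt_delta hν₂, ⟨hd, hd2⟩, ⟨fun _ => NegMass.pDelta_eq_pS hn1,
    fun _ h _ => NegMass.pDelta_eq_pF hn1 h.le, fun h => h.elim
      (fun h1 => by rw [h1, Nat.cast_one, NegMass.pDelta_one])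
      fun h => NegMass.pDelta_eq_top_of_le_sqrt h.2⟩, fun p hp hpδ f g hf hg hfg R hR => ?_⟩
  have heat := hδ ▸ NegMass.exists_lifespan_le_heat hp hR hν₁ hν₂ hβ hf hg hfg
  rcases le_or_gt (n - NegMass.dStar n) √δ with hcase | hcase
  · obtain ⟨C, hC, h⟩ := heat (NegMass.gammaF_pos hp (NegMass.pDelta_eq_pF hn1 hcase ▸ hpδ))
    refine ⟨1, one_pos, C, hC, fun ε hε hε1 => ⟨fun _ => by linarith, fun _ _ => by linarith,
      fun _ => ⟨h ε hε hε1, ?_⟩⟩⟩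
    rw [NegMass.two_div_sub_eq_gammaF_div hp.ne', inv_div]
  rcases le_or_gt p (2 / (n - √δ)) with hpn | hpn
  · have hmul := (le_div_iff₀ (by linarith)).1 hpn
    obtain ⟨C, hC, h⟩ := heat (NegMass.gammaF_pos_of_lt_pDelta hn1 hp hpδ hmul)
    exact ⟨1, one_pos, C, hC, fun ε hε hε1 => ⟨fun _ => by nlinarith, fun _ _ =>
      ⟨fun _ => h ε hε hε1, fun _ => by linarith⟩, fun _ => by linarith⟩⟩
  · have hmul := (div_lt_iff₀ (by linarith)).1 hpn
    obtain ⟨C, hC, h⟩ := NegMass.exists_lifespan_le_wave hn hp hR hν₁ hν₂.le hβ hf hg hfg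
      (NegMass.gammaS_pos_of_lt_pDelta hn1 hp hpδ hmul.le)
    exact ⟨1, one_pos, C, hC, fun ε hε hε1 => ⟨fun _ => h ε hε hε1, fun _ _ =>
      ⟨fun _ => by linarith, fun _ => h ε hε hε1⟩, fun _ => by linarith⟩⟩
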